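/- **Setting.** For an integer $q\ge 1$ let $\mathbb Z_q=\{i\in\mathbb Z: -q/2\le i<q/2\}$ and $a \bmod q=a-\lfloor (a+q/2)/q\rfloor q\in\mathbb Z_q$. For finite $\mathcal S\subset\mathbb Z$, $\mathcal N_{\mathcal S}(m,w)$ denotes the distribution on $\mathcal S$ with weights proportional to $e^{-(x-m)^2/(2w)}$. The smoothing parameter $\eta_\epsilon=\eta_\epsilon(\mathbb Z)$ is the infimum of the $s>0$ with $\sum_{w\in\mathbb Z\setminus\{0\}}e^{-\pi s^2w^2}\le\epsilon$. $\mathcal U_K$ is the uniform distribution on $\{-K,\dots,K\}$, and $\Delta(\cdot,\cdot)$ is statistical (total variation) distance. Let $r\ge1$ be an integer, $P\in\mathbb Z_q^{Np\times v}$ a public matrix, $s\in\mathbb Z_q^v$ a secret vector, $T_c\in\mathbb Z^{Np\times M}$, $\sigma>0$ and $0<\epsilon<1$. Let $e=(e_1,\dots,e_M)$ have independent entries $e_j\sim\mathcal N_{\mathbb Z_q}(0,\sigma^2)$, put $e^\rho=T_ce$ and $\Sigma_p=\sigma^2T_cT_c^\top$, and let $\rho$ be a random vector in $\mathbb Z^{Np}$,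 independent of $e$. The encrypted residual is $\rho^e=(P,\;Ps+r\rho+e^\rho \bmod q)$; decryption is $\mathrm{Dec}_s(P,b)=\lfloor ((b-Ps)\bmod q)/r\rceil$, entrywise. For integers $\epsilon_\infty,\epsilon_0\ge0$ the null hypothesis $\mathcal H_0^e$ says of a message $m$ that $\|m\|_\infty\le\epsilon_\infty$ and $\|m\|_0\le\epsilon_0$; assume that $\rho$ satisfies it almost surely. Let $d\in\mathbb Z_q^{Np}$ satisfy $d^\top P=0\bmod q$, so that $d^\top\rho^e\bmod q=(0,X)$ with $X\in\mathbb Z_q$. Let $\|d_{\epsilon_0}\|_1$ be the sum of the $\epsilon_0$ largest absolute values of entries of $d$, $K=\epsilon_\infty\|d_{\epsilon_0}\|_1$ and $c=T_c^\top d$. Fix $\kappa>0$, the constant in the $\mathcal O(\epsilon)$ of the assumptions, and assume: * the entries of $c$ have greatest common divisor $1$; * $\|c\|_2^2\,\eta_\epsilon^2\le\sigma^2<\frac{q^2}{4}\frac{\Omega_\epsilon^2}{\|c\|_2^2}$ for some $0<\Omega_\epsilon<1$, and $\Pr(\|c\|_2|Z|>q/2)\le\kappa\epsilon$ for $Z\sim\mathcal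 N_{\mathbb Z_q}(0,\sigma^2)$. **Proposition.** There is a constant $C$ depending only on $\kappa$ such that the following holds for all such data. Let $Y$ be the random variable on $\mathbb Z_q$ with $$\Pr(Y=y)=\frac1{1+2K}\sum_{k=-K}^{K}g\big((y-kr)\bmod q\big),\qquad g\text{ the mass function of }\mathcal N_{\mathbb Z_q}(0,d^\top\Sigma_pd).$$ If $\mathcal S\subseteq\mathbb Z_q$ and $\Pr(Y\in\mathcal S)=\alpha$, then the test that rejects $\mathcal H_0^e$ when $X\in\mathcal S$ has Type I error $$\big|\Pr(X\in\mathcal S)-\alpha\big|\le C\big(\epsilon+\Delta(d^\top\rho,\,\mathcal U_K)\big).$$ In particular, under the approximation in which $d^\top\rho$ is uniform on $\{-K,\dots,K\}$, the Type I error is $\alpha$ up to $C\epsilon$. Moreover: * the same holds if $Y$ is instead the uniform mixture of $\mathcal N_{\mathbb Z_q}(kr,d^\top\Sigma_pd)$, $|k|\le K$, provided there is no overflow up to $\mathcal O(\epsilon)$: $\Pr(r\,d^\top\rho+d^\top e^\rho\notin\mathbb Z_q)\le\kappa\epsilon$; * in both cases, if decryption fails with small probability, $\Pr(\mathrm{Dec}_s(\rho^e)\ne\rho)\le\kappa\epsilon$,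 the same bound holds with $\Pr(X\in\mathcal S)$ replaced by the conditional probability of $X\in\mathcal S$ given that $\mathrm{Dec}_s(\rho^e)$ satisfies $\mathcal H_0^e$. -/

import Mathlib

noncomputable section

namespace LWEDetect

open scoped Matrix

/-! ### Arithmetic modulo `q` with centred representatives -/

/-- The integers modulo `q`, i.e. `{i ∈ ℤ | -q/2 ≤ i < q/2}`. -/
def Zq (q : ℕ) : Finset ℤ :=
  (Finset.Icc (-(q : ℤ)) (q : ℤ)).filter (fun i => -(q : ℤ) ≤ 2 * i ∧ 2 * i < (q : ℤ))

/-- The modulus operation `a mod q = a - ⌊(a + q/2)/q⌋ q`; the quotient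
`⌊(a + q/2)/q⌋ = ⌊(2a + q)/(2q)⌋` is written as an integer (floor) division. -/
def cmod (a : ℤ) (q : ℕ) : ℤ := a - ((2 * a + q) / (2 * q)) * q

theorem cmod_eq_floor (a : ℤ) (q : ℕ) :
    cmod a q = a - ⌊((a : ℚ) + (q : ℚ) / 2) / (q : ℚ)⌋ * (q : ℤ) := by
  have h : ((a : ℚ) + (q : ℚ) / 2) / (q : ℚ)
      = ((2 * a + q : ℤ) : ℚ) / ((2 * q : ℕ) : ℚ) := by
    rcases Nat.eq_zero_or_pos q with h0 | h0
    · subst h0; simp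
    · have : (q : ℚ) ≠ 0 := by positivity
      push_cast
      field_simp
  rw [h, Rat.floor_intCast_div_natCast]
  simp [cmod]

theorem cmod_mem_Zq (a : ℤ) {q : ℕ} (hq : 0 < q) : cmod a q ∈ Zq q := by
  have h2 : (0 : ℤ) < 2 * (q : ℤ) := by positivity
  have h := Int.mul_ediv_add_emod (2 * a + q) (2 * q)
  have h0 := Int.emod_nonneg (2 * a + q) h2.ne'
  have h1 := Int.emod_lt_of_pos (2 * a + q) h2
  have h3 : 2 * cmod a q = (2 * a + q) % (2 * q) - q := by
    unfold cmod
    linear_combination -h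
  simp only [Zq, Finset.mem_filter, Finset.mem_Icc]
  omega

/-! ### Distributions on the integers -/

/-- Probability mass function of the discrete normal distribution with support `S`
and parameters `m` and `w` (in the role of the variance). -/
def discreteNormal (S : Finset ℤ) (m w : ℝ) (x : ℤ) : ℝ :=
  if x ∈ S then
    Real.exp (-((x : ℝ) - m) ^ 2 / (2 * w)) / ∑ y ∈ S, Real.exp (-((y : ℝ) - m) ^ 2 / (2 * w))
  else 0

/-- Probability mass function of the uniform distribution on `{-K, …, K}`. -/
def symUniform (K : ℕ) (k : ℤ) : ℝ :=
  if k ∈ Finset.Icc (-(K : ℤ)) (K : ℤ) then 1 / (1 + 2 * (K : ℝ)) else 0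

/-- Statistical (total variation) distance of two mass functions on the integers. -/
def statDist (f g : ℤ → ℝ) : ℝ := (1 / 2) * ∑' x : ℤ, |f x - g x|

/-- The mass function on `Zq q` given by
`y ↦ (1 + 2K)⁻¹ ∑_{k = -K}^{K} Pr(X = y - k r)` with `X` discrete normal on `Zq q`,
centred at `0`; the difference `y - k r` is taken modulo `q`. -/
def shiftMixture (q r K : ℕ) (w : ℝ) (y : ℤ) : ℝ :=
  (1 / (1 + 2 * (K : ℝ))) *
    ∑ k ∈ Finset.Icc (-(K : ℤ)) (K : ℤ), discreteNormal (Zq q) 0 w (cmod (y - k * r) q)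

/-- The uniform mixture of the discrete normal distributions on `Zq q` with means `k r`,
`|k| ≤ K`. -/
def meanMixture (q r K : ℕ) (w : ℝ) (y : ℤ) : ℝ :=
  (1 / (1 + 2 * (K : ℝ))) *
    ∑ k ∈ Finset.Icc (-(K : ℤ)) (K : ℤ), discreteNormal (Zq q) ((k : ℝ) * (r : ℝ)) w y

/-! ### The smoothing parameter of a lattice -/

/-- The dual of a lattice `L`: the vectors in the real span of `L` whose inner products with
all lattice points are integers. -/
def dualLattice {E : Type*} [NormedAddCommGroup E] [InnerProductSpace ℝ E]
    (L : AddSubgroup E) : Set E :=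
  {w | w ∈ Submodule.span ℝ (L : Set E) ∧ ∀ x ∈ L, ∃ n : ℤ, inner ℝ x w = (n : ℝ)}

/-- The smoothing parameter `η_ε(L)`: the smallest `s > 0` such that
`∑_{w ∈ L* \ {0}} exp (-π s² ‖w‖²) ≤ ε`. -/
def smoothingParameter {E : Type*} [NormedAddCommGroup E] [InnerProductSpace ℝ E]
    (L : AddSubgroup E) (ε : ℝ) : ℝ :=
  sInf {s : ℝ | 0 < s ∧
    ∑' w : {w : E // w ∈ dualLattice L ∧ w ≠ 0},
      ENNReal.ofReal (Real.exp (-Real.pi * (s * ‖(w : E)‖) ^ 2)) ≤ ENNReal.ofReal ε}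

/-- The lattice `ℤ` in `ℝ`. -/
def intLattice : AddSubgroup ℝ := (Int.castAddHom ℝ).range

/-! ### LWE encryption, decryption and filtering -/

section LWE

variable {ι ν : Type*} [Fintype ι] [Fintype ν]

/-- Encryption of the message `m` with public matrix `P`, secret `s` and error `e`:
the pair `(P, P s + r m + e mod q)`. -/
def encrypt (q r : ℕ) (s : ν → ℤ) (P : Matrix ι ν ℤ) (m e : ι → ℤ) :
    Matrix ι ν ℤ × (ι → ℤ) :=
  (P, fun i => cmod ((P *ᵥ s) i + r * m i + e i) q)

/-- Decryption with the secret `s`: remove `P s` modulo `q`, divide by `r` and round. -/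
def decrypt (q r : ℕ) (s : ν → ℤ) (c : Matrix ι ν ℤ × (ι → ℤ)) : ι → ℤ :=
  fun i => round (((cmod (c.2 i - (c.1 *ᵥ s) i) q : ℤ) : ℚ) / (r : ℚ))

/-- The kernel modulo `q` of a matrix `V`: the `u` with entries in `Zq q` and `V u = 0 mod q`. -/
def kerMod (q : ℕ) (V : Matrix ν ι ℤ) : Set (ι → ℤ) :=
  {u | (∀ i, u i ∈ Zq q) ∧ ∀ j, cmod ((V *ᵥ u) j) q = 0}

/-- The linear combination `dᵀ c mod q` of the rows of a ciphertext `c = (P, b)`, that is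
`(dᵀ P mod q, dᵀ b mod q)`. -/
def filterCiphertext (q : ℕ) (d : ι → ℤ) (c : Matrix ι ν ℤ × (ι → ℤ)) : (ν → ℤ) × ℤ :=
  (fun j => cmod ((d ᵥ* c.1) j) q, cmod (d ⬝ᵥ c.2) q)

/-- The null hypothesis on a message vector `m`: `‖m‖_∞ ≤ εinf` and `‖m‖₀ ≤ ε₀`. -/
def NullHypothesis (εinf ε₀ : ℕ) (m : ι → ℤ) : Prop :=
  (∀ i, |m i| ≤ (εinf : ℤ)) ∧ (Finset.univ.filter (fun i => m i ≠ 0)).card ≤ ε₀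

/-- `‖d_{ε₀}‖₁`: the sum of the `ε₀` largest absolute values of the entries of `d` (of all of
them if there are fewer than `ε₀`). -/
def largestL1 (ε₀ : ℕ) (d : ι → ℤ) : ℕ :=
  ((((Finset.univ : Finset ι).val.map (fun i => (d i).natAbs)).sort (· ≥ ·)).take ε₀).sum

/-- The covariance matrix `Σ_p = σ² T Tᵀ` of `T e`, for `e` with independent entries of
variance `σ²`. -/
def residualCov (σ : ℝ) (T : Matrix ι ν ℤ) : Matrix ι ι ℝ :=
  σ ^ 2 • (T.map (Int.cast : ℤ → ℝ) * (T.map (Int.cast : ℤ → ℝ))ᵀ)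

/-- The variance `dᵀ Σ_p d`. -/
def filteredVar (σ : ℝ) (T : Matrix ι ν ℤ) (d : ι → ℤ) : ℝ :=
  (fun i => (d i : ℝ)) ⬝ᵥ (residualCov σ T *ᵥ (fun i => (d i : ℝ)))

/-- The Euclidean norm `‖Tᵀ d‖₂`. -/
def filteredNorm (T : Matrix ι ν ℤ) (d : ι → ℤ) : ℝ :=
  Real.sqrt (∑ j, (((Tᵀ *ᵥ d) j : ℤ) : ℝ) ^ 2)

end LWE

end LWEDetect

end

noncomputable section

namespace LWEDetect

open MeasureTheory ProbabilityTheory Matrix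
open scoped ENNReal NNReal

/-! ### Gaussian sums over the integers -/

/-! Since `dᵀP = 0 mod q`, the filtered quantity is `X = r (d ⬝ᵥ ρ) + c ⬝ᵥ e mod q`, with `c = Tᵀd`
and the two summands independent. Replacing `d ⬝ᵥ ρ` by a uniform variable costs at most twice the
statistical distance (`measure_indep_le`). It remains to compare `W = c ⬝ᵥ e` with a discrete normal
variable of variance `n v`, where `n = ‖c‖²` and `v = σ²`. Only upper bounds are needed: a bound for
every set of residues, applied also to complements, is two-sided (`abs_measure_sub_le`). Upper
bounds allow each truncated law of `e j` to be replaced by the full Gaussian weight on `ℤ` divided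
by the mass of the window.

For full Gaussian weights, projecting `x` onto `c` gives `∏ gauss v (x i) = gauss (n v) z · ∏ gauss
v (x i - z c i / n)` whenever `c ⬝ᵥ x = z`. The sum of the last factor over the hyperplane is
bounded uniformly in `z`: Fourier inversion writes it as an integral over `θ`, Poisson summation
turns the integrand into a Gaussian sum of the distances from `θ c` to integer vectors `m`, and a
Bézout vector `a ⬝ᵥ c = 1` unfolds the integral to the whole line. The term `m = 0` gives `1 /
√(2πnv)`. Every other term is governed by the distance of `m` from the line through `c`, that is, by
the `2 × 2` minors of `(c, m)`, and the smoothing condition makes their total at most `ε` relative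
to the main term (`tsum_transverse_le`).

Truncation enters through `(√(2πv) / windowMass)^M`, where `M` is the number of nonzero entries of
`c`. As `M ≤ n`, each factor may exceed `1` by only `O(ε / n)`. The tail assumption concerns the
threshold `q / (2√n)`; moving out to `q / 2` gains the missing `1 / n` (`gaussTail_le_outerMass`).
Rescaled by `√n`, the same assumption shows that `W` leaves the residues with probability `O(ε)`
(`gaussTail_scaled_le`). Two degenerate cases are separate: for `n = 1`, `W` is `± e i`; for `v < 36
n`, the smoothing condition bounds `ε` from below and the claim is trivial. -/

/-- The unnormalised Gaussian weight with variance parameter `v`. -/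
def gauss (v x : ℝ) : ℝ := Real.exp (-x ^ 2 / (2 * v))

/-- The total mass of the Gaussian weight on the integers. -/
def gaussMass (v : ℝ) : ℝ := ∑' x : ℤ, gauss v x

/-- The mass of the Gaussian weight on the integers `≥ N`. -/
def gaussTail (v : ℝ) (N : ℕ) : ℝ := ∑' k : ℕ, gauss v ((N + k : ℕ) : ℝ)

theorem gauss_pos (v x : ℝ) : 0 < gauss v x := Real.exp_pos _

theorem gauss_neg (v x : ℝ) : gauss v (-x) = gauss v x := by simp [gauss]

theorem gauss_le_gauss {v x y : ℝ} (hv : 0 < v) (h : |y| ≤ |x|) : gauss v x ≤ gauss v y := by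
  unfold gauss
  have := sq_le_sq.2 h
  gcongr

theorem summable_exp_neg_mul_int_sq {b : ℝ} (hb : 0 < b) :
    Summable fun m : ℤ => Real.exp (-b * (m : ℝ) ^ 2) := by
  have h := summable_pow_mul_jacobiTheta₂_term_bound 0 (T := b / Real.pi) (by positivity) 0
  refine h.congr fun m => ?_
  simp only [pow_zero, one_mul]
  congr 1
  field_simp
  ring

theorem summable_gauss {v : ℝ} (hv : 0 < v) : Summable fun x : ℤ => gauss v x := by
  refine (summable_exp_neg_mul_int_sq (b := 1 / (2 * v)) (by positivity)).congr fun m => ?_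
  unfold gauss
  congr 1
  field_simp

theorem summable_gauss_nat {v : ℝ} (hv : 0 < v) : Summable fun x : ℕ => gauss v x :=
  ((summable_gauss hv).comp_injective Nat.cast_injective).congr fun x => by simp

theorem summable_gaussTail {v : ℝ} (hv : 0 < v) (N : ℕ) :
    Summable fun k : ℕ => gauss v ((N + k : ℕ) : ℝ) :=
  (summable_gauss_nat hv).comp_injective (add_right_injective N)

theorem gaussTail_nonneg (v : ℝ) (N : ℕ) : 0 ≤ gaussTail v N :=
  tsum_nonneg fun _ => (gauss_pos _ _).le

/-- Termwise, `(N + m + k)² ≥ ((N + m)² - N²) + (N + k)²`, the difference being the cross term `2mk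
≥ 0`. -/
theorem gaussTail_add_le {v : ℝ} (hv : 0 < v) (N m : ℕ) :
    gaussTail v (N + m) ≤
      Real.exp (-((N + m : ℝ) ^ 2 - (N : ℝ) ^ 2) / (2 * v)) * gaussTail v N := by
  unfold gaussTail
  rw [← tsum_mul_left]
  refine (summable_gaussTail hv _).tsum_le_tsum (fun k => ?_) ((summable_gaussTail hv _).mul_left _)
  unfold gauss
  rw [← Real.exp_add, ← add_div]
  have : (0 : ℝ) ≤ (m : ℝ) * k := by positivity
  gcongr
  push_cast
  nlinarith

theorem gaussTail_eq_sum_add {v : ℝ} (hv : 0 < v) (N m : ℕ) :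
    gaussTail v N = ∑ k ∈ Finset.range m, gauss v ((N + k : ℕ) : ℝ) + gaussTail v (N + m) := by
  unfold gaussTail
  rw [← (summable_gaussTail hv N).sum_add_tsum_nat_add m]
  congr 2
  ext k
  congr 2
  omega

theorem gaussTail_le_mass {v : ℝ} (hv : 0 < v) (N : ℕ) : gaussTail v N ≤ gaussMass v := by
  have hinj : Function.Injective fun k : ℕ => ((N + k : ℕ) : ℤ) := fun a b h => by
    simpa using h
  have := tsum_comp_le_tsum_of_inj (summable_gauss hv) (fun a => (gauss_pos v a).le) hinj
  simpa [gaussTail, gaussMass, Function.comp_def] using this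

theorem gaussMass_pos {v : ℝ} (hv : 0 < v) : 0 < gaussMass v :=
  (summable_gauss hv).tsum_pos (fun _ => (gauss_pos _ _).le) 0 (gauss_pos _ _)

/-- Since `m² ≥ |m|`, two geometric series dominate the nonzero terms; for `X ≤ 1/4` their sum `2X /
(1 - X)` is at most `3X`. -/
theorem tsum_exp_neg_mul_int_sq_le {b : ℝ} (hb : 0 < b) (hb4 : Real.exp (-b) ≤ 1 / 4) :
    ∑' m : ℤ, Real.exp (-b * (m : ℝ) ^ 2) ≤ 1 + 3 * Real.exp (-b) := by
  set X := Real.exp (-b) with hX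
  have hX0 : 0 < X := Real.exp_pos _
  have hs := summable_exp_neg_mul_int_sq hb
  rw [tsum_int_eq_zero_add_two_mul_tsum_pnat (fun n => by simp) hs]
  rw [tsum_pnat_eq_tsum_succ (f := fun n : ℕ => Real.exp (-b * (((n : ℕ) : ℤ) : ℝ) ^ 2))]
  have hg : HasSum (fun k : ℕ => X * X ^ k) (X * (1 - X)⁻¹) :=
    (hasSum_geometric_of_lt_one hX0.le (by linarith)).mul_left X
  have hle : ∀ k : ℕ, Real.exp (-b * (((k + 1 : ℕ) : ℤ) : ℝ) ^ 2) ≤ X * X ^ k := fun k => by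
    rw [hX, ← Real.exp_nat_mul, ← Real.exp_add]
    refine Real.exp_le_exp.2 ?_
    push_cast
    have : (0 : ℝ) ≤ b * k := by positivity
    have : (0 : ℝ) ≤ b * k * k := by positivity
    nlinarith
  have hs' : Summable fun k : ℕ => Real.exp (-b * (((k + 1 : ℕ) : ℤ) : ℝ) ^ 2) :=
    Summable.of_nonneg_of_le (fun _ => (Real.exp_pos _).le) hle hg.summable
  have h1 := hs'.tsum_le_tsum hle hg.summable
  rw [hg.tsum_eq] at h1
  have h2 : X * (1 - X)⁻¹ ≤ 3 / 2 * X := by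
    have : (1 - X)⁻¹ ≤ 3 / 2 := by
      rw [inv_le_comm₀ (by linarith) (by norm_num)]
      norm_num
      linarith
    nlinarith
  simp only [Int.cast_zero] at *
  norm_num at h1 ⊢
  linarith

/-- Poisson summation: the dual sum is `1` up to an exponentially small error, so the mass is
essentially that of the integral. -/
theorem gaussMass_eq {v : ℝ} (hv : 0 < v) :
    gaussMass v = Real.sqrt (2 * Real.pi * v) *
      ∑' m : ℤ, Real.exp (-(2 * Real.pi ^ 2 * v) * (m : ℝ) ^ 2) := by
  have h := Real.tsum_exp_neg_mul_int_sq (a := 1 / (2 * Real.pi * v)) (by positivity)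
  have h1 : gaussMass v = ∑' n : ℤ, Real.exp (-Real.pi * (1 / (2 * Real.pi * v)) * (n : ℝ) ^ 2) := by
    unfold gaussMass gauss
    congr 1
    ext n
    congr 1
    field_simp
  rw [h1, h, ← Real.sqrt_eq_rpow, one_div, one_div, Real.sqrt_inv, inv_inv]
  congr 2
  ext n
  congr 2
  field_simp

theorem sqrt_le_gaussMass {v : ℝ} (hv : 0 < v) : Real.sqrt (2 * Real.pi * v) ≤ gaussMass v := by
  rw [gaussMass_eq hv]
  have hb : 0 < 2 * Real.pi ^ 2 * v := by positivity
  have := (summable_exp_neg_mul_int_sq hb).le_tsum 0 (fun _ _ => (Real.exp_pos _).le)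
  simp only [Int.cast_zero] at this
  norm_num at this
  refine le_mul_of_one_le_right (Real.sqrt_nonneg _) (by convert this using 3; norm_num)

theorem gaussMass_le {v : ℝ} (hv : 0 < v) (h4 : Real.exp (-(2 * Real.pi ^ 2 * v)) ≤ 1 / 4) :
    gaussMass v ≤ Real.sqrt (2 * Real.pi * v) * (1 + 3 * Real.exp (-(2 * Real.pi ^ 2 * v))) := by
  rw [gaussMass_eq hv]
  exact mul_le_mul_of_nonneg_left (tsum_exp_neg_mul_int_sq_le (by positivity) h4)
    (Real.sqrt_nonneg _)

/-- A window of the Gaussian mass is at most the total mass. -/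
theorem sum_gauss_le_mass {v : ℝ} (hv : 0 < v) (S : Finset ℤ) (a : ℤ) :
    ∑ x ∈ S, gauss v ((x - a : ℤ) : ℝ) ≤ gaussMass v := by
  have h := (summable_gauss hv).sum_le_tsum (S.map (Equiv.subRight a).toEmbedding)
    (fun _ _ => (gauss_pos _ _).le)
  simpa [Finset.sum_map, gaussMass] using h

/-- Comparing the tail at scale `√n` with the tail at scale `1`. -/
theorem gaussTail_mul_le {v : ℝ} (hv : 0 < v) {R : ℝ} (hR : 1 ≤ R) (N N' : ℕ)
    (h : (N' : ℝ) * R ≤ N) :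
    gaussTail (R ^ 2 * v) N ≤ 2 * R * gaussTail v N' := by
  have hR0 : 0 < R := by linarith
  set l : ℕ := ⌈R⌉₊ with hl
  have hfl : ∀ k : ℕ, N' ≤ ⌊((N + k : ℕ) : ℝ) / R⌋₊ := fun k => by
    refine Nat.le_floor ?_
    rw [le_div_iff₀ hR0]
    push_cast
    have : (0 : ℝ) ≤ k := by positivity
    linarith
  -- An integer `y = N + k` is sent to `x = ⌊y / R⌋`, counted from `N'`, and to its position among
  -- the integers of `[xR, (x + 1)R)`. There are at most `l = ⌈R⌉` of them, and `gauss (R² v) y =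
  -- gauss v (y / R) ≤ gauss v x`.
  let i : ℕ → ℕ × Fin l := fun k =>
    (⌊((N + k : ℕ) : ℝ) / R⌋₊ - N',
      ⟨(N + k) - ⌈(⌊((N + k : ℕ) : ℝ) / R⌋₊ : ℝ) * R⌉₊, by
        set x := ⌊((N + k : ℕ) : ℝ) / R⌋₊
        have h1 : ((N + k : ℕ) : ℝ) / R < x + 1 := Nat.lt_floor_add_one _
        rw [div_lt_iff₀ hR0] at h1
        have h2 : (x : ℝ) * R ≤ ⌈(x : ℝ) * R⌉₊ := Nat.le_ceil _
        have h3 : R ≤ l := Nat.le_ceil _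
        have h0 : 0 < l := Nat.ceil_pos.2 hR0
        have h4 : ((N + k : ℕ) : ℝ) < ((l + ⌈(x : ℝ) * R⌉₊ : ℕ) : ℝ) := by
          push_cast at *
          linarith
        have h5 := Nat.cast_lt.1 h4
        omega⟩)
  have hx : ∀ k : ℕ, ⌈(⌊((N + k : ℕ) : ℝ) / R⌋₊ : ℝ) * R⌉₊ ≤ N + k := fun k => by
    refine Nat.ceil_le.2 ?_
    rw [← le_div_iff₀ hR0]
    exact Nat.floor_le (by positivity)
  have hi : Function.Injective i := fun a b hab => by
    simp only [i, Prod.mk.injEq, Fin.mk.injEq] at hab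
    obtain ⟨h1, h2⟩ := hab
    have h3 : ⌊((N + a : ℕ) : ℝ) / R⌋₊ = ⌊((N + b : ℕ) : ℝ) / R⌋₊ := by
      have := hfl a
      have := hfl b
      omega
    have h4 := hx a
    have h5 := hx b
    rw [h3] at h2 h4
    omega
  have hs : Summable fun p : ℕ × Fin l => gauss v ((N' + p.1 : ℕ) : ℝ) := by
    have := (summable_gaussTail hv N').mul_of_nonneg (g := fun _ : Fin l => (1 : ℝ))
      (Summable.of_finite) (fun _ => (gauss_pos _ _).le) (fun _ => zero_le_one)
    simpa using this
  have key : gaussTail (R ^ 2 * v) N ≤ ∑' p : ℕ × Fin l, gauss v ((N' + p.1 : ℕ) : ℝ) := by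
    refine Summable.tsum_le_tsum_of_inj i hi (fun _ _ => (gauss_pos _ _).le) (fun k => ?_)
      (summable_gaussTail (by positivity) N) hs
    have h1 : (⌊((N + k : ℕ) : ℝ) / R⌋₊ : ℝ) ≤ ((N + k : ℕ) : ℝ) / R := Nat.floor_le (by positivity)
    have h2 : N' + (i k).1 = ⌊((N + k : ℕ) : ℝ) / R⌋₊ := by
      have := hfl k
      simp only [i]
      omega
    rw [h2]
    have h3 : gauss (R ^ 2 * v) ((N + k : ℕ) : ℝ) = gauss v (((N + k : ℕ) : ℝ) / R) := by
      unfold gauss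
      congr 1
      field_simp
    rw [h3]
    refine gauss_le_gauss hv ?_
    rwa [abs_of_nonneg (by positivity), abs_of_nonneg (by positivity)]
  refine key.trans ?_
  have h3 : ∑' p : ℕ × Fin l, gauss v ((N' + p.1 : ℕ) : ℝ) = l * gaussTail v N' := by
    rw [hs.tsum_prod]
    simp [gaussTail, tsum_mul_left]
  rw [h3]
  have h4 : (l : ℝ) ≤ 2 * R := by
    have := Nat.ceil_lt_add_one hR0.le
    linarith
  exact mul_le_mul_of_nonneg_right h4 (gaussTail_nonneg _ _)

section

/-! ### Measures on the integers given by weights -/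

/-- The measure on the integers with the given weights. -/
def weightMeasure (f : ℤ → ℝ≥0) : Measure ℤ := Measure.count.withDensity fun x => (f x : ℝ≥0∞)

instance (f : ℤ → ℝ≥0) : SigmaFinite (weightMeasure f) := by
  unfold weightMeasure; infer_instance

theorem weightMeasure_singleton (f : ℤ → ℝ≥0) (x : ℤ) : weightMeasure f {x} = f x := by
  simp [weightMeasure, withDensity_apply]

theorem weightMeasure_univ (f : ℤ → ℝ≥0) : weightMeasure f Set.univ = ∑' x, (f x : ℝ≥0∞) := by
  simp [weightMeasure, lintegral_count]

variable {ι : Type*} [Fintype ι]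

theorem pi_weightMeasure_apply (f : ι → ℤ → ℝ≥0) (A : Set (ι → ℤ)) :
    Measure.pi (fun i => weightMeasure (f i)) A =
      ∑' x : ι → ℤ, A.indicator (fun x => ∏ i, (f i (x i) : ℝ≥0∞)) x := by
  classical
  have hA : MeasurableSet A := MeasurableSet.of_discrete
  rw [← lintegral_indicator_one hA, lintegral_countable']
  congr 1
  ext x
  rw [Measure.pi_singleton]
  simp only [weightMeasure_singleton]
  by_cases hx : x ∈ A <;> simp [hx]

/-- Both sides are the total mass of a product measure. -/
theorem ennreal_prod_tsum (f : ι → ℤ → ℝ≥0) :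
    ∏ i, ∑' m : ℤ, (f i m : ℝ≥0∞) = ∑' x : ι → ℤ, ∏ i, (f i (x i) : ℝ≥0∞) := by
  have h := pi_weightMeasure_apply f Set.univ
  rw [Measure.pi_univ] at h
  simpa [weightMeasure_univ] using h

/-! ### Fourier bound for the law of an integer linear form -/

open Complex in
theorem integral_exp_int (k : ℤ) :
    ∫ θ in Set.Ioc (0 : ℝ) 1, exp (2 * Real.pi * I * θ * k) = if k = 0 then 1 else 0 := by
  rw [← intervalIntegral.integral_of_le zero_le_one]
  split_ifs with hk
  · simp [hk]
  · have hc : (2 * Real.pi * I * k : ℂ) ≠ 0 := by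
      simp [hk, Real.pi_ne_zero]
    have := integral_exp_mul_complex (a := 0) (b := 1) hc
    have h0 : ∀ θ : ℝ, exp (2 * Real.pi * I * θ * k) = exp (2 * Real.pi * I * k * θ) := fun θ => by
      congr 1; ring
    simp_rw [h0]
    rw [this]
    have h1 : exp (2 * Real.pi * I * k * ((1 : ℝ) : ℂ)) = 1 := by
      rw [Complex.exp_eq_one_iff]
      exact ⟨k, by push_cast; ring⟩
    rw [h1]
    simp

-- Fourier inversion: the indicator of `c ⬝ᵥ x = z` is the integral over a period of `exp (2πiθ(c ⬝ᵥ
-- x - z))`. After Fubini the integral over `x` factorises, and taking norms removes the phase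
-- carrying `z`.
open Complex in
theorem pi_linearForm_le (ν : ι → Measure ℤ) [∀ i, IsFiniteMeasure (ν i)] (c : ι → ℤ) (z : ℤ) :
    Measure.pi ν {x | c ⬝ᵥ x = z} ≤
      ∫⁻ θ in Set.Ioc (0 : ℝ) 1, ∏ i, ‖∫ x, exp (2 * Real.pi * I * θ * (c i * x : ℤ)) ∂ν i‖ₑ := by
  set π := Measure.pi ν with hπ
  set F : (ι → ℤ) → ℝ → ℂ := fun x θ => exp (2 * Real.pi * I * θ * ((c ⬝ᵥ x - z : ℤ) : ℂ)) with hF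
  have hnorm : ∀ x θ, ‖F x θ‖ = 1 := fun x θ => by
    have : (2 * Real.pi * I * θ * ((c ⬝ᵥ x - z : ℤ) : ℂ) : ℂ) =
        ((2 * Real.pi * θ * ((c ⬝ᵥ x - z : ℤ) : ℝ) : ℝ) : ℂ) * I := by
      push_cast; ring
    simp only [hF]
    rw [this, Complex.norm_exp_ofReal_mul_I]
  have hmeas : Measurable (Function.uncurry F) := by
    refine measurable_from_prod_countable_right fun x => ?_
    simp only [Function.uncurry, hF]
    fun_prop
  have hint : Integrable (Function.uncurry F) (π.prod (volume.restrict (Set.Ioc (0 : ℝ) 1))) := by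
    refine Integrable.of_bound hmeas.aestronglyMeasurable 1 (ae_of_all _ fun p => ?_)
    exact (hnorm p.1 p.2).le
  have hswap := integral_integral_swap (f := F) hint
  have hL : ∫ x, (∫ θ in Set.Ioc (0 : ℝ) 1, F x θ) ∂π = (π.real {x | c ⬝ᵥ x = z} : ℂ) := by
    have : ∀ x, ∫ θ in Set.Ioc (0 : ℝ) 1, F x θ =
        Set.indicator {x | c ⬝ᵥ x = z} (fun _ => (1 : ℂ)) x := fun x => by
      simp only [hF]
      rw [integral_exp_int]
      simp [Set.indicator_apply, sub_eq_zero]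
    simp_rw [this]
    rw [integral_indicator MeasurableSet.of_discrete]
    simp
  have hfac : ∀ θ : ℝ, ‖∫ x, F x θ ∂π‖ₑ =
      ∏ i, ‖∫ x, exp (2 * Real.pi * I * θ * (c i * x : ℤ)) ∂ν i‖ₑ := fun θ => by
    have h1 : ∀ x : ι → ℤ, F x θ = exp (-(2 * Real.pi * I * θ * z)) *
        ∏ i, exp (2 * Real.pi * I * θ * (c i * x i : ℤ)) := fun x => by
      simp only [hF]
      rw [← Complex.exp_sum, ← Complex.exp_add, ← Finset.mul_sum]
      congr 1
      simp only [dotProduct]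
      push_cast
      ring
    simp_rw [h1]
    rw [integral_const_mul, hπ,
      integral_fintype_prod_eq_prod (f := fun i (x : ℤ) => exp (2 * Real.pi * I * θ * (c i * x : ℤ))),
      enorm_mul]
    have h2 : ‖exp (-(2 * Real.pi * I * θ * z))‖ₑ = 1 := by
      have : (-(2 * Real.pi * I * θ * z) : ℂ) = ((-(2 * Real.pi * θ * z) : ℝ) : ℂ) * I := by
        push_cast; ring
      rw [this, ← ofReal_norm, Complex.norm_exp_ofReal_mul_I]
      simp
    rw [h2, one_mul]
    simp [enorm_eq_nnnorm, nnnorm_prod]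
  calc π {x | c ⬝ᵥ x = z} = ‖(π.real {x | c ⬝ᵥ x = z} : ℂ)‖ₑ := by
        rw [← ofReal_norm, Complex.norm_real, Real.norm_of_nonneg measureReal_nonneg,
          ofReal_measureReal]
    _ = ‖∫ θ in Set.Ioc (0 : ℝ) 1, (∫ x, F x θ ∂π)‖ₑ := by rw [← hL, hswap]
    _ ≤ ∫⁻ θ in Set.Ioc (0 : ℝ) 1, ‖∫ x, F x θ ∂π‖ₑ := enorm_integral_le_lintegral_enorm _
    _ = _ := by simp_rw [hfac]

/-! ### Poisson summation for a shifted and modulated Gaussian -/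

/-- From `(x - 2a)² ≥ 0` it follows that `(x - a)² ≥ x² / 2 - a²`, so a centred Gaussian of variance
`2v` dominates. -/
theorem summable_shiftGauss {v : ℝ} (hv : 0 < v) (a : ℝ) :
    Summable fun x : ℤ => gauss v (x - a) := by
  refine Summable.of_nonneg_of_le (fun _ => (gauss_pos _ _).le) (fun x => ?_)
    ((summable_gauss (v := 2 * v) (by positivity)).mul_left (Real.exp (a ^ 2 / (2 * v))))
  unfold gauss
  rw [← Real.exp_add]
  refine Real.exp_le_exp.2 ?_
  rw [div_add_div _ _ (by positivity) (by positivity), div_le_div_iff₀ (by positivity) (by positivity)]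
  have : 0 ≤ ((x : ℝ) - 2 * a) ^ 2 * v ^ 2 := by positivity
  nlinarith

/-- The weights of the Gaussian centred at `a`. -/
def shiftWeight (v a : ℝ) (x : ℤ) : ℝ≥0 := (gauss v (x - a)).toNNReal

instance shiftWeight_finite {v : ℝ} [hv : Fact (0 < v)] (a : ℝ) :
    IsFiniteMeasure (weightMeasure (shiftWeight v a)) := by
  refine ⟨?_⟩
  rw [weightMeasure_univ]
  refine lt_top_iff_ne_top.2 (ENNReal.tsum_coe_ne_top_iff_summable.2 ?_)
  exact (summable_shiftGauss hv.out a).toNNReal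

/-- The dual Gaussian weights. -/
def dualWeight (v θ : ℝ) (m : ℤ) : ℝ≥0 :=
  (Real.exp (-(2 * Real.pi ^ 2 * v) * (θ - m) ^ 2)).toNNReal

-- After Poisson summation the centre `a` appears only in phases of the dual terms, which the norm
-- discards; hence a bound independent of `a`.
open Complex in
theorem enorm_integral_shiftWeight_le {v : ℝ} (hv : 0 < v) (a θ : ℝ) :
    ‖∫ x, exp (2 * Real.pi * I * θ * (x : ℤ)) ∂weightMeasure (shiftWeight v a)‖ₑ ≤
      ENNReal.ofReal (Real.sqrt (2 * Real.pi * v)) * ∑' m : ℤ, (dualWeight v θ m : ℝ≥0∞) := by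
  have : Fact (0 < v) := ⟨hv⟩
  have hpi := Real.pi_pos
  have hI : Integrable (fun x : ℤ => exp (2 * Real.pi * I * θ * (x : ℤ)))
      (weightMeasure (shiftWeight v a)) := by
    refine Integrable.of_bound (Measurable.of_discrete).aestronglyMeasurable 1
      (ae_of_all _ fun x => ?_)
    have : (2 * Real.pi * I * θ * (x : ℤ) : ℂ) = ((2 * Real.pi * θ * x : ℝ) : ℂ) * I := by
      push_cast; ring
    rw [this, Complex.norm_exp_ofReal_mul_I]
  rw [integral_countable hI]
  have hreal : ∀ x : ℤ, (weightMeasure (shiftWeight v a)).real {x} = gauss v (x - a) := fun x => by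
    rw [measureReal_def, weightMeasure_singleton, ENNReal.coe_toReal, shiftWeight,
      Real.coe_toNNReal _ (gauss_pos _ _).le]
  simp_rw [hreal]
  set A : ℂ := ((1 / (2 * Real.pi * v) : ℝ) : ℂ) with hA
  set b : ℂ := ((a / (2 * Real.pi * v) : ℝ) : ℂ) + I * θ with hb
  have hvC : (v : ℂ) ≠ 0 := by exact_mod_cast hv.ne'
  have hpC : (Real.pi : ℂ) ≠ 0 := by exact_mod_cast hpi.ne'
  have hP := Complex.tsum_exp_neg_quadratic (a := A) (by rw [hA, Complex.ofReal_re]; positivity) b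
  have h1 : ∀ x : ℤ, gauss v (x - a) • exp (2 * Real.pi * I * θ * (x : ℤ)) =
      (Real.exp (-a ^ 2 / (2 * v)) : ℂ) * exp (-Real.pi * A * x ^ 2 + 2 * Real.pi * b * x) := fun x => by
    rw [Complex.real_smul, gauss, Complex.ofReal_exp, Complex.ofReal_exp, ← Complex.exp_add,
      ← Complex.exp_add]
    congr 1
    rw [hA, hb]
    push_cast
    field_simp
    ring
  simp_rw [h1]
  rw [tsum_mul_left, hP, enorm_mul, enorm_mul]
  have hA2 : ‖(1 / A ^ (1 / 2 : ℂ))‖ₑ = ENNReal.ofReal (Real.sqrt (2 * Real.pi * v)) := by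
    rw [← ofReal_norm]
    congr 1
    rw [norm_div, hA, Complex.norm_cpow_eq_rpow_re_of_pos (by positivity)]
    have h2 : ((1 / 2 : ℂ)).re = 1 / 2 := by norm_num
    rw [h2, ← Real.sqrt_eq_rpow, one_div (2 * Real.pi * v), Real.sqrt_inv]
    simp
  have hterm : ∀ n : ℤ, ‖exp (-Real.pi / A * (n + I * b) ^ 2)‖ₑ =
      ENNReal.ofReal (Real.exp (a ^ 2 / (2 * v))) * dualWeight v θ n := fun n => by
    rw [← ofReal_norm, Complex.norm_exp]
    have : (dualWeight v θ n : ℝ≥0∞) =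
        ENNReal.ofReal (Real.exp (-(2 * Real.pi ^ 2 * v) * (θ - n) ^ 2)) := rfl
    rw [this, ← ENNReal.ofReal_mul (Real.exp_pos _).le, ← Real.exp_add]
    congr 2
    have h2 : (-Real.pi / A * (n + I * b) ^ 2 : ℂ) =
        ((a ^ 2 / (2 * v) + -(2 * Real.pi ^ 2 * v) * (θ - n) ^ 2 : ℝ) : ℂ) +
        ((-2 * Real.pi * a * (n - θ) : ℝ) : ℂ) * I := by
      rw [hA, hb]
      push_cast
      field_simp
      ring_nf
      simp only [I_sq, I_pow_four, I_pow_three]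
      ring_nf
    rw [h2, Complex.add_re, Complex.re_ofReal_mul, Complex.ofReal_re, Complex.I_re, mul_zero, add_zero]
  have hsum : ‖∑' n : ℤ, exp (-Real.pi / A * (n + I * b) ^ 2)‖ₑ ≤
      ENNReal.ofReal (Real.exp (a ^ 2 / (2 * v))) * ∑' m : ℤ, (dualWeight v θ m : ℝ≥0∞) := by
    refine (enorm_tsum_le_tsum_enorm).trans ?_
    simp_rw [hterm]
    rw [ENNReal.tsum_mul_left]
  rw [hA2, ← ofReal_norm, Complex.norm_real, Real.norm_of_nonneg (Real.exp_pos _).le]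
  calc _ ≤ ENNReal.ofReal (Real.exp (-a ^ 2 / (2 * v))) *
        (ENNReal.ofReal (Real.sqrt (2 * Real.pi * v)) *
        (ENNReal.ofReal (Real.exp (a ^ 2 / (2 * v))) * ∑' m : ℤ, (dualWeight v θ m : ℝ≥0∞))) := by
        gcongr
    _ = (ENNReal.ofReal (Real.exp (-a ^ 2 / (2 * v))) * ENNReal.ofReal (Real.exp (a ^ 2 / (2 * v)))) *
        (ENNReal.ofReal (Real.sqrt (2 * Real.pi * v)) * ∑' m : ℤ, (dualWeight v θ m : ℝ≥0∞)) := by ring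
    _ = _ := by
        rw [← ENNReal.ofReal_mul (Real.exp_pos _).le, ← Real.exp_add, neg_div, neg_add_cancel]
        simp

end

section

variable {ι : Type*} [Fintype ι]

/-! ### The dual sum of an integer linear form -/

/-- The sum of the squared `2 × 2` minors of `(c, m)` that involve the index `i`. -/
def minorSq (c m : ι → ℤ) (i : ι) : ℤ := ∑ j, (c i * m j - c j * m i) ^ 2

/-- Lagrange's identity, with each unordered pair of indices counted twice. -/
theorem sum_minorSq (c m : ι → ℤ) :
    ∑ i, minorSq c m i = 2 * ((c ⬝ᵥ c) * (m ⬝ᵥ m) - (c ⬝ᵥ m) ^ 2) := by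
  have h1 : (c ⬝ᵥ c) * (m ⬝ᵥ m) = ∑ i, ∑ j, c i ^ 2 * m j ^ 2 := by
    simp only [dotProduct, Finset.sum_mul_sum]
    exact Finset.sum_congr rfl fun i _ => Finset.sum_congr rfl fun j _ => by ring
  have h2 : (c ⬝ᵥ c) * (m ⬝ᵥ m) = ∑ i, ∑ j, c j ^ 2 * m i ^ 2 := by
    rw [h1, Finset.sum_comm]
  have h3 : (c ⬝ᵥ m) ^ 2 = ∑ i, ∑ j, c i * m i * (c j * m j) := by
    simp only [dotProduct, sq, Finset.sum_mul_sum]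
  have h4 : ∑ i, minorSq c m i = (∑ i, ∑ j, c i ^ 2 * m j ^ 2) + (∑ i, ∑ j, c j ^ 2 * m i ^ 2)
      - 2 * ∑ i, ∑ j, c i * m i * (c j * m j) := by
    simp only [Finset.mul_sum, ← Finset.sum_add_distrib, ← Finset.sum_sub_distrib, minorSq]
    exact Finset.sum_congr rfl fun i _ => Finset.sum_congr rfl fun j _ => by ring
  rw [h4, ← h1, ← h2, ← h3]
  ring

/-- Vanishing minors make `m` proportional to `c`. Pairing with the Bézout vector `a` shows that the
factor is `a ⬝ᵥ m = 0`. -/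
theorem eq_zero_of_minors {a c m : ι → ℤ} (hac : a ⬝ᵥ c = 1) (ham : a ⬝ᵥ m = 0) {i : ι}
    (hci : c i ≠ 0) (h : ∀ j, c i * m j = c j * m i) : m = 0 := by
  have h1 : c i * (a ⬝ᵥ m) = (a ⬝ᵥ c) * m i := by
    simp only [dotProduct, Finset.mul_sum, Finset.sum_mul]
    exact Finset.sum_congr rfl fun j _ => by linear_combination (a j) * h j
  rw [ham, hac, mul_zero, one_mul] at h1
  funext j
  have := h j
  rw [← h1, mul_zero] at this
  simpa [hci] using this

theorem one_le_minorSq {a c m : ι → ℤ} (hac : a ⬝ᵥ c = 1) (ham : a ⬝ᵥ m = 0) {i : ι}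
    (hci : c i ≠ 0) (hm : m ≠ 0) : 1 ≤ minorSq c m i := by
  by_contra! h
  refine hm (eq_zero_of_minors hac ham hci fun j => ?_)
  have h1 := Finset.single_le_sum (f := fun j => (c i * m j - c j * m i) ^ 2)
    (fun j _ => sq_nonneg _) (Finset.mem_univ j)
  have h2 : (c i * m j - c j * m i) ^ 2 ≤ 0 := by
    unfold minorSq at h
    exact h1.trans (by linarith)
  have := pow_eq_zero_iff (two_ne_zero) |>.1 (le_antisymm h2 (sq_nonneg _))
  linarith

/-- As `c` has no zero entry, each of the other rows of minors contributes at least `1`. The summand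
`card ι` later provides one small factor per coordinate, and `6` is chosen below `2π`. -/
theorem minorSq_add_card_le {a c m : ι → ℤ} (hac : a ⬝ᵥ c = 1) (ham : a ⬝ᵥ m = 0)
    (hc : ∀ i, c i ≠ 0) (hm : m ≠ 0) (i : ι) :
    minorSq c m i + Fintype.card ι ≤ 6 * ((c ⬝ᵥ c) * (m ⬝ᵥ m) - (c ⬝ᵥ m) ^ 2) := by
  classical
  have h1 : minorSq c m i + ((Fintype.card ι : ℤ) - 1) ≤ ∑ i, minorSq c m i := by
    rw [← Finset.add_sum_erase _ _ (Finset.mem_univ i)]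
    have := Finset.card_nsmul_le_sum (Finset.univ.erase i) (minorSq c m) 1
      fun j _ => one_le_minorSq hac ham (hc j) hm
    rw [Finset.card_erase_of_mem (Finset.mem_univ i), Finset.card_univ] at this
    have h0 : 0 < Fintype.card ι := Fintype.card_pos_iff.2 ⟨i⟩
    simp only [nsmul_eq_mul, mul_one] at this
    rw [Nat.cast_sub h0] at this
    push_cast at this
    linarith
  have h2 := sum_minorSq c m
  have h3 := one_le_minorSq hac ham (hc i) hm
  have h0 : 1 ≤ (Fintype.card ι : ℤ) := by exact_mod_cast Fintype.card_pos_iff.2 ⟨i⟩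
  linarith

theorem tsum_lintegral_Ioc_sub (f : ℝ → ℝ≥0∞) :
    ∑' k : ℤ, ∫⁻ θ in Set.Ioc (0 : ℝ) 1, f (θ - k) = ∫⁻ θ, f θ := by
  have h1 : ∀ k : ℤ, ∫⁻ θ in Set.Ioc (0 : ℝ) 1, f (θ - k) =
      ∫⁻ θ in Set.Ioc (((-k : ℤ) : ℝ)) ((-k : ℤ) + 1), f θ := fun k => by
    have hmp := measurePreserving_sub_right (volume : Measure ℝ) (k : ℝ)
    have he : MeasurableEmbedding fun x : ℝ => x - k := measurableEmbedding_subRight _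
    rw [← hmp.setLIntegral_comp_preimage_emb he f]
    congr 2
    ext x
    simp only [Set.mem_Ioc, Set.mem_preimage]
    push_cast
    constructor <;> rintro ⟨h, h'⟩ <;> constructor <;> linarith
  simp_rw [h1]
  have h2 := (Equiv.neg ℤ).tsum_eq (fun k : ℤ => ∫⁻ θ in Set.Ioc (k : ℝ) (k + 1), f θ)
  simp only [Equiv.neg_apply] at h2
  rw [h2, ← lintegral_iUnion (fun _ => measurableSet_Ioc) (Set.pairwise_disjoint_Ioc_intCast ℝ),
    iUnion_Ioc_intCast, setLIntegral_univ]

/-- The Gaussian weight at `m` of the line `θ ↦ θ c`. -/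
def lineGauss (v : ℝ) (c m : ι → ℤ) (θ : ℝ) : ℝ≥0∞ :=
  ENNReal.ofReal (Real.exp (-(2 * Real.pi ^ 2 * v) * ∑ i, (c i * θ - m i) ^ 2))

theorem prod_dualWeight (v : ℝ) (c m : ι → ℤ) (θ : ℝ) :
    ∏ i, (dualWeight v (c i * θ) (m i) : ℝ≥0∞) = lineGauss v c m θ := by
  unfold lineGauss
  rw [Finset.mul_sum, Real.exp_sum, ENNReal.ofReal_prod_of_nonneg fun _ _ => (Real.exp_pos _).le]
  rfl

/-- This invariance permits unfolding: translating `m` along `c` amounts to translating `θ` by an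
integer. -/
theorem lineGauss_sub (v : ℝ) (c m : ι → ℤ) (k : ℤ) (θ : ℝ) :
    lineGauss v c (m - k • c) (θ - k) = lineGauss v c m θ := by
  unfold lineGauss
  congr 4
  ext i
  simp
  ring

/-- Completing the square in `θ` leaves a Gaussian integral times the weight of the squared distance
from `m` to the line through `c`, which is `(‖c‖²‖m‖² - (c ⬝ᵥ m)²) / ‖c‖²`. -/
theorem lintegral_lineGauss {v : ℝ} (hv : 0 < v) {c : ι → ℤ} (hc : 0 < c ⬝ᵥ c) (m : ι → ℤ) :
    ∫⁻ θ, lineGauss v c m θ = ENNReal.ofReal (1 / Real.sqrt (2 * Real.pi * ((c ⬝ᵥ c : ℤ) * v))) *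
      ENNReal.ofReal (Real.exp (-(2 * Real.pi ^ 2 * v / (c ⬝ᵥ c : ℤ)) *
        ((c ⬝ᵥ c) * (m ⬝ᵥ m) - (c ⬝ᵥ m) ^ 2 : ℤ))) := by
  have hn : (0 : ℝ) < (c ⬝ᵥ c : ℤ) := by exact_mod_cast hc
  set n : ℝ := ((c ⬝ᵥ c : ℤ) : ℝ) with hn'
  set s : ℝ := ((c ⬝ᵥ m : ℤ) : ℝ) with hs'
  have hsq : ∀ θ : ℝ, ∑ i, (c i * θ - m i : ℝ) ^ 2 =
      n * (θ - s / n) ^ 2 + ((n * (m ⬝ᵥ m : ℤ) - s ^ 2)) / n := fun θ => by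
    have : ∑ i, (c i * θ - m i : ℝ) ^ 2 = n * θ ^ 2 - 2 * θ * s + (m ⬝ᵥ m : ℤ) := by
      simp only [hn', hs', dotProduct]
      push_cast
      simp only [Finset.mul_sum, Finset.sum_mul, ← Finset.sum_add_distrib, ← Finset.sum_sub_distrib]
      exact Finset.sum_congr rfl fun i _ => by ring
    rw [this]
    field_simp
    ring
  have hfun : ∀ θ : ℝ, lineGauss v c m θ =
      ENNReal.ofReal (Real.exp (-(2 * Real.pi ^ 2 * v / n) * ((n * (m ⬝ᵥ m : ℤ) - s ^ 2)))) *
      ENNReal.ofReal (Real.exp (-(2 * Real.pi ^ 2 * v * n) * (θ - s / n) ^ 2)) := fun θ => by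
    unfold lineGauss
    rw [← ENNReal.ofReal_mul (Real.exp_pos _).le, ← Real.exp_add, hsq]
    congr 2
    field_simp
    ring
  simp_rw [hfun]
  rw [lintegral_const_mul _ (by fun_prop), mul_comm]
  congr 1
  · have hint := integrable_exp_neg_mul_sq (b := 2 * Real.pi ^ 2 * v * n) (by positivity)
    rw [lintegral_sub_right_eq_self
      (fun θ => ENNReal.ofReal (Real.exp (-(2 * Real.pi ^ 2 * v * n) * θ ^ 2))),
      ← ofReal_integral_eq_lintegral_ofReal hint (ae_of_all _ fun _ => (Real.exp_pos _).le),
      integral_gaussian]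
    congr 1
    rw [← Real.sqrt_one, ← Real.sqrt_div zero_le_one]
    congr 1
    field_simp
  · push_cast
    rfl

/-- Put `B = πv / n`. A nonzero `m` is determined by its row `u` of minors with a fixed index `i`,
and its term is at most `exp(-B)^M · ∏ exp(-B (u j)²)`. Summing over all `u` in `ℤ^M` costs at most
`2^M`, so the nonzero terms total at most `(2 exp(-B))^M ≤ ε`. The factor `exp(-B)^M` is what keeps
the bound free of the dimension. -/
theorem tsum_transverse_le {v ε : ℝ} (hv : 0 < v) (hε1 : ε ≤ 1) {a c : ι → ℤ}
    (hac : a ⬝ᵥ c = 1) (hc : ∀ i, c i ≠ 0)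
    (h4 : Real.exp (-(Real.pi * v / (c ⬝ᵥ c : ℤ))) ≤ 1 / 4)
    (hε : Real.exp (-(Real.pi * v / (c ⬝ᵥ c : ℤ))) ≤ ε / 2) :
    ∑' m : {m : ι → ℤ // a ⬝ᵥ m = 0}, 
      ENNReal.ofReal (Real.exp (-(2 * Real.pi ^ 2 * v / (c ⬝ᵥ c : ℤ)) *
        ((c ⬝ᵥ c) * (m.1 ⬝ᵥ m.1) - (c ⬝ᵥ m.1) ^ 2 : ℤ))) ≤ ENNReal.ofReal (1 + ε) := by
  classical
  have hne : Nonempty ι := by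
    by_contra h
    rw [not_nonempty_iff] at h
    simp [dotProduct] at hac
  obtain ⟨i⟩ := hne
  have hn0 : 0 < c ⬝ᵥ c := by
    refine lt_of_lt_of_le (pow_pos (abs_pos.2 (hc i)) 2) ?_
    rw [sq_abs, sq]
    exact Finset.single_le_sum (f := fun i => c i * c i) (fun j _ => mul_self_nonneg _)
      (Finset.mem_univ i)
  have hn : (0 : ℝ) < (c ⬝ᵥ c : ℤ) := by exact_mod_cast hn0
  set n : ℝ := ((c ⬝ᵥ c : ℤ) : ℝ) with hn'
  set B : ℝ := Real.pi * v / n with hB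
  have hB0 : 0 < B := by positivity
  set M := Fintype.card ι with hM
  have hM1 : 1 ≤ M := Fintype.card_pos_iff.2 ⟨i⟩
  let f : ι → ℤ → ℝ≥0 := fun _ m => (Real.exp (-B * (m : ℝ) ^ 2)).toNNReal
  let u : (ι → ℤ) → (ι → ℤ) := fun m j => c i * m j - c j * m i
  have hterm : ∀ m : {m : ι → ℤ // a ⬝ᵥ m = 0},
      ENNReal.ofReal (Real.exp (-(2 * Real.pi ^ 2 * v / n) *
        ((c ⬝ᵥ c) * (m.1 ⬝ᵥ m.1) - (c ⬝ᵥ m.1) ^ 2 : ℤ))) ≤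
      (if m = ⟨0, by simp⟩ then 1 else 0) +
        ENNReal.ofReal (Real.exp (-B)) ^ M * ∏ j, (f j (u m.1 j) : ℝ≥0∞) := fun m => by
    split_ifs with hm
    · refine le_add_right ?_
      simp [hm]
    · rw [zero_add]
      have hm0 : m.1 ≠ 0 := fun h => hm (Subtype.ext h)
      have hQ := minorSq_add_card_le hac m.2 hc hm0 i
      have hQ' : ((minorSq c m.1 i : ℤ) : ℝ) + M ≤
          6 * ((c ⬝ᵥ c) * (m.1 ⬝ᵥ m.1) - (c ⬝ᵥ m.1) ^ 2 : ℤ) := by exact_mod_cast hQ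
      have hprod : ENNReal.ofReal (Real.exp (-B)) ^ M * ∏ j, (f j (u m.1 j) : ℝ≥0∞) =
          ENNReal.ofReal (Real.exp (-B * ((minorSq c m.1 i : ℤ) + M))) := by
        rw [← ENNReal.ofReal_pow (Real.exp_pos _).le, ← Real.exp_nat_mul, mul_add, Real.exp_add,
          mul_comm, ENNReal.ofReal_mul (Real.exp_pos _).le]
        congr 1
        · simp only [minorSq]
          push_cast
          rw [Finset.mul_sum, Real.exp_sum,
            ENNReal.ofReal_prod_of_nonneg fun _ _ => (Real.exp_pos _).le]
          simp [f, u, ENNReal.ofReal]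
        · rw [mul_comm]
      rw [hprod]
      refine ENNReal.ofReal_le_ofReal (Real.exp_le_exp.2 ?_)
      set Q : ℝ := (((c ⬝ᵥ c) * (m.1 ⬝ᵥ m.1) - (c ⬝ᵥ m.1) ^ 2 : ℤ) : ℝ) with hQd
      have h1 : 2 * Real.pi ^ 2 * v / n = B * (2 * Real.pi) := by
        rw [hB]; ring
      rw [h1]
      have hQ0 : 0 ≤ Q := by
        have : (0 : ℝ) ≤ ((minorSq c m.1 i : ℤ) : ℝ) := by
          exact Int.cast_nonneg (Finset.sum_nonneg fun _ _ => sq_nonneg _)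
        have : (0 : ℝ) ≤ M := by positivity
        linarith
      have h2 : ((minorSq c m.1 i : ℤ) : ℝ) + M ≤ 2 * Real.pi * Q := by
        nlinarith [Real.pi_gt_three]
      have := mul_le_mul_of_nonneg_left h2 hB0.le
      linarith
  have hinj : Function.Injective fun m : {m : ι → ℤ // a ⬝ᵥ m = 0} => u m.1 := fun m m' h => by
    refine Subtype.ext (sub_eq_zero.1 ?_)
    refine eq_zero_of_minors hac (m := m.1 - m'.1) (by rw [dotProduct_sub, m.2, m'.2, sub_zero])
      (hc i) fun j => ?_
    have := congrFun h j
    simp only [u] at this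
    simp only [Pi.sub_apply]
    linear_combination this
  refine (ENNReal.tsum_le_tsum hterm).trans ?_
  rw [ENNReal.tsum_add, tsum_ite_eq, ENNReal.tsum_mul_left, ENNReal.ofReal_add zero_le_one
    (by linarith [Real.exp_pos (-B)]), ENNReal.ofReal_one]
  gcongr
  have h1 : ∑' m : {m : ι → ℤ // a ⬝ᵥ m = 0}, ∏ j, (f j (u m.1 j) : ℝ≥0∞) ≤
      ENNReal.ofReal 2 ^ M := by
    refine (ENNReal.tsum_comp_le_tsum_of_injective hinj
      (fun x : ι → ℤ => ∏ j, (f j (x j) : ℝ≥0∞))).trans ?_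
    rw [← ennreal_prod_tsum, hM]
    simp only [f, Finset.prod_const, Finset.card_univ]
    gcongr
    change ∑' m : ℤ, ENNReal.ofReal (Real.exp (-B * (m : ℝ) ^ 2)) ≤ _
    rw [← ENNReal.ofReal_tsum_of_nonneg (fun _ => (Real.exp_pos _).le)
      (summable_exp_neg_mul_int_sq hB0)]
    refine ENNReal.ofReal_le_ofReal ((tsum_exp_neg_mul_int_sq_le hB0 h4).trans ?_)
    linarith
  calc _ ≤ ENNReal.ofReal (Real.exp (-B)) ^ M * ENNReal.ofReal 2 ^ M := by gcongr
    _ = ENNReal.ofReal ((Real.exp (-B) * 2) ^ M) := by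
        rw [← mul_pow, ← ENNReal.ofReal_mul (Real.exp_pos _).le, ENNReal.ofReal_pow (by positivity)]
    _ ≤ _ := by
        refine ENNReal.ofReal_le_ofReal ?_
        have h2 : Real.exp (-B) * 2 ≤ ε := by linarith
        have h3 : 0 ≤ Real.exp (-B) * 2 := by positivity
        calc _ ≤ Real.exp (-B) * 2 := pow_le_of_le_one h3 (h2.trans hε1) (by omega)
          _ ≤ ε := h2

/-- Every `m` is uniquely `m₀ + k c` with `a ⬝ᵥ m₀ = 0` and `k = a ⬝ᵥ m`. Summing over `k` unfolds
the integral over a period into one over the line; the sum over `m₀` is the transverse sum. -/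
theorem lintegral_prod_dualWeight_le {v ε : ℝ} (hv : 0 < v) (hε1 : ε ≤ 1) {a c : ι → ℤ}
    (hac : a ⬝ᵥ c = 1) (hc : ∀ i, c i ≠ 0) (hcc : 0 < c ⬝ᵥ c)
    (h4 : Real.exp (-(Real.pi * v / (c ⬝ᵥ c : ℤ))) ≤ 1 / 4)
    (hε : Real.exp (-(Real.pi * v / (c ⬝ᵥ c : ℤ))) ≤ ε / 2) :
    ∫⁻ θ in Set.Ioc (0 : ℝ) 1, ∏ i, ∑' m : ℤ, (dualWeight v (c i * θ) m : ℝ≥0∞) ≤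
      ENNReal.ofReal ((1 + ε) / Real.sqrt (2 * Real.pi * ((c ⬝ᵥ c : ℤ) * v))) := by
  simp_rw [ennreal_prod_tsum, prod_dualWeight]
  rw [lintegral_tsum fun m => by unfold lineGauss; fun_prop]
  let φ : (ι → ℤ) → {m : ι → ℤ // a ⬝ᵥ m = 0} × ℤ := fun m =>
    (⟨m - (a ⬝ᵥ m) • c, by rw [dotProduct_sub, dotProduct_smul, hac]; simp⟩, a ⬝ᵥ m)
  have hφ : Function.Injective φ := fun m m' h => by
    simp only [φ, Prod.mk.injEq, Subtype.mk.injEq] at h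
    obtain ⟨h1, h2⟩ := h
    rw [h2] at h1
    exact sub_left_injective h1
  let G : {m : ι → ℤ // a ⬝ᵥ m = 0} × ℤ → ℝ≥0∞ := fun p =>
    ∫⁻ θ in Set.Ioc (0 : ℝ) 1, lineGauss v c p.1.1 (θ - p.2)
  have hG : ∀ m : ι → ℤ, ∫⁻ θ in Set.Ioc (0 : ℝ) 1, lineGauss v c m θ = G (φ m) := fun m => by
    simp only [G, φ, lineGauss_sub]
  simp_rw [hG]
  refine (ENNReal.tsum_comp_le_tsum_of_injective hφ G).trans ?_
  rw [ENNReal.tsum_prod']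
  simp only [G]
  have hline : ∀ m : ι → ℤ, ∑' k : ℤ, ∫⁻ θ in Set.Ioc (0 : ℝ) 1, lineGauss v c m (θ - k) = _ :=
    fun m => (tsum_lintegral_Ioc_sub (lineGauss v c m)).trans (lintegral_lineGauss hv hcc m)
  simp_rw [hline, ENNReal.tsum_mul_left]
  refine (mul_le_mul_right (tsum_transverse_le hv hε1 hac hc h4 hε) _).trans ?_
  rw [← ENNReal.ofReal_mul (by positivity)]
  refine ENNReal.ofReal_le_ofReal (le_of_eq ?_)
  ring

end

section

variable {ι : Type*} [Fintype ι]

/-! ### The law of an integer linear form of independent Gaussian variables -/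

/-- Pythagoras: `z c / n` is the orthogonal projection of `x` on the line through `c`, and its
squared norm is `z² / n`. -/
theorem prod_gauss_of_dotProduct_eq {v : ℝ} (hv : 0 < v) {c x : ι → ℤ} {z : ℤ}
    (hcc : 0 < c ⬝ᵥ c) (h : c ⬝ᵥ x = z) :
    ∏ i, gauss v (x i) = gauss (((c ⬝ᵥ c : ℤ) : ℝ) * v) z *
      ∏ i, gauss v (x i - z * c i / ((c ⬝ᵥ c : ℤ) : ℝ)) := by
  have hn : (0 : ℝ) < ((c ⬝ᵥ c : ℤ) : ℝ) := by exact_mod_cast hcc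
  set n : ℝ := ((c ⬝ᵥ c : ℤ) : ℝ) with hn'
  unfold gauss
  rw [← Real.exp_sum, ← Real.exp_sum, ← Real.exp_add]
  congr 1
  have hz : (z : ℝ) = ∑ i, (c i : ℝ) * x i := by
    rw [← h]; simp [dotProduct]
  have h1 : ∑ i, ((x i : ℝ) - z * c i / n) ^ 2 = ∑ i, (x i : ℝ) ^ 2 - (z : ℝ) ^ 2 / n := by
    have h2 : ∑ i, ((x i : ℝ) - z * c i / n) ^ 2 =
        ∑ i, (x i : ℝ) ^ 2 - 2 * z / n * (∑ i, (c i : ℝ) * x i) + z ^ 2 / n ^ 2 * n := by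
      rw [show z ^ 2 / n ^ 2 * n = ∑ i, z ^ 2 / n ^ 2 * ((c i : ℝ) * c i) by
        rw [← Finset.mul_sum, hn']; simp [dotProduct]]
      rw [Finset.mul_sum, ← Finset.sum_sub_distrib, ← Finset.sum_add_distrib]
      exact Finset.sum_congr rfl fun i _ => by field_simp; ring
    rw [h2, ← hz]
    field_simp
    ring
  rw [← Finset.sum_div, ← Finset.sum_div, Finset.sum_neg_distrib, Finset.sum_neg_distrib, h1]
  field_simp
  ring

theorem measure_linearForm_le {Ω : Type*} [MeasurableSpace Ω] {μ : Measure Ω}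
    [IsProbabilityMeasure μ] {Y : ι → Ω → ℤ} (hY : ∀ j, Measurable (Y j)) (hind : iIndepFun Y μ)
    {v ε Z : ℝ} (hv : 0 < v) (hZ : 0 < Z) (hε0 : 0 ≤ ε) (hε1 : ε ≤ 1)
    (hlaw : ∀ j x, μ.real {ω | Y j ω = x} ≤ gauss v x / Z)
    {a c : ι → ℤ} (hac : a ⬝ᵥ c = 1) (hc : ∀ i, c i ≠ 0) (hcc : 0 < c ⬝ᵥ c)
    (h4 : Real.exp (-(Real.pi * v / ((c ⬝ᵥ c : ℤ) : ℝ))) ≤ 1 / 4)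
    (hε : Real.exp (-(Real.pi * v / ((c ⬝ᵥ c : ℤ) : ℝ))) ≤ ε / 2) (z : ℤ) :
    μ.real {ω | c ⬝ᵥ (fun j => Y j ω) = z} ≤
      (Real.sqrt (2 * Real.pi * v) / Z) ^ Fintype.card ι *
        ((1 + ε) / Real.sqrt (2 * Real.pi * (((c ⬝ᵥ c : ℤ) : ℝ) * v))) *
          gauss (((c ⬝ᵥ c : ℤ) : ℝ) * v) z := by
  have : Fact (0 < v) := ⟨hv⟩
  set n : ℝ := ((c ⬝ᵥ c : ℤ) : ℝ) with hn'
  have hn : 0 < n := by rw [hn']; exact_mod_cast hcc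
  refine ENNReal.toReal_le_of_le_ofReal (by have := gauss_pos (n * v) z; positivity) ?_
  let f : ι → ℤ → ℝ≥0 := fun i x => (gauss v x / Z).toNNReal
  let A : Set (ι → ℤ) := {x | c ⬝ᵥ x = z}
  have hpt : ∀ j x, (μ.map (Y j)) {x} ≤ f j x := fun j x => by
    rw [Measure.map_apply (hY j) (measurableSet_singleton x)]
    refine (ENNReal.le_ofReal_iff_toReal_le (measure_ne_top _ _) ?_).2 (hlaw j x)
    exact div_nonneg (gauss_pos _ _).le hZ.le
  have hmapY : Measurable fun ω j => Y j ω := measurable_pi_lambda _ hY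
  have h1 : μ {ω | c ⬝ᵥ (fun j => Y j ω) = z} =
      Measure.pi (fun j => μ.map (Y j)) A := by
    rw [← (iIndepFun_iff_map_fun_eq_pi_map fun j => (hY j).aemeasurable).1 hind,
      Measure.map_apply hmapY MeasurableSet.of_discrete]
    rfl
  have hprob : ∀ j, IsProbabilityMeasure (μ.map (Y j)) := fun j =>
    Measure.isProbabilityMeasure_map (hY j).aemeasurable
  have h2 : Measure.pi (fun j => μ.map (Y j)) A ≤
      ∑' x : ι → ℤ, A.indicator (fun x => ∏ i, (f i (x i) : ℝ≥0∞)) x := by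
    classical
    rw [← lintegral_indicator_one MeasurableSet.of_discrete, lintegral_countable']
    refine ENNReal.tsum_le_tsum fun x => ?_
    rw [Measure.pi_singleton]
    by_cases hx : x ∈ A
    · simp only [hx, Set.indicator_of_mem, Pi.one_apply, one_mul]
      exact Finset.prod_le_prod' fun i _ => hpt i _
    · simp [hx]
  have h3 : ∀ x : ι → ℤ, A.indicator (fun x => ∏ i, (f i (x i) : ℝ≥0∞)) x =
      ENNReal.ofReal ((1 / Z) ^ Fintype.card ι * gauss (n * v) z) *
        A.indicator (fun x => ∏ i, (shiftWeight v (z * c i / n) (x i) : ℝ≥0∞)) x := fun x => by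
    by_cases hx : x ∈ A
    · simp only [hx, Set.indicator_of_mem]
      have e1 : ∏ i, (f i (x i) : ℝ≥0∞) = ENNReal.ofReal (∏ i, gauss v (x i) / Z) := by
        rw [ENNReal.ofReal_prod_of_nonneg fun _ _ => div_nonneg (gauss_pos _ _).le hZ.le]
        rfl
      have e2 : ∏ i, (shiftWeight v (z * c i / n) (x i) : ℝ≥0∞) =
          ENNReal.ofReal (∏ i, gauss v (x i - z * c i / n)) := by
        rw [ENNReal.ofReal_prod_of_nonneg fun _ _ => (gauss_pos _ _).le]
        rfl
      rw [e1, e2, ← ENNReal.ofReal_mul (by have := gauss_pos (n * v) z; positivity)]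
      congr 1
      rw [mul_assoc, hn', ← prod_gauss_of_dotProduct_eq hv hcc hx]
      simp only [div_eq_mul_inv, one_mul, Finset.prod_mul_distrib, Finset.prod_const,
        Finset.card_univ]
      ring
    · simp [hx]
  rw [h1]
  refine h2.trans ?_
  simp_rw [h3]
  rw [ENNReal.tsum_mul_left, ← pi_weightMeasure_apply]
  have h5 := pi_linearForm_le (fun i => weightMeasure (shiftWeight v (z * c i / n))) c z
  have h6 : ∫⁻ θ in Set.Ioc (0 : ℝ) 1, ∏ i, ‖∫ x, Complex.exp (2 * Real.pi * Complex.I * θ *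
        (c i * x : ℤ)) ∂weightMeasure (shiftWeight v (z * c i / n))‖ₑ ≤
      ENNReal.ofReal (Real.sqrt (2 * Real.pi * v)) ^ Fintype.card ι *
      ∫⁻ θ in Set.Ioc (0 : ℝ) 1, ∏ i, ∑' m : ℤ, (dualWeight v (c i * θ) m : ℝ≥0∞) := by
    rw [← lintegral_const_mul' _ _ (by finiteness)]
    refine lintegral_mono fun θ => ?_
    dsimp only
    rw [← Finset.card_univ, ← Finset.prod_const, ← Finset.prod_mul_distrib]
    refine Finset.prod_le_prod' fun i _ => ?_
    have := enorm_integral_shiftWeight_le hv (z * c i / n) (c i * θ)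
    have h7 : ∀ x : ℤ, Complex.exp (2 * Real.pi * Complex.I * θ * (c i * x : ℤ)) =
        Complex.exp (2 * Real.pi * Complex.I * ((c i * θ : ℝ) : ℂ) * (x : ℤ)) := fun x => by
      congr 1
      push_cast
      ring
    simpa only [h7] using this
  calc _ ≤ ENNReal.ofReal ((1 / Z) ^ Fintype.card ι * gauss (n * v) z) *
        (ENNReal.ofReal (Real.sqrt (2 * Real.pi * v)) ^ Fintype.card ι *
        ENNReal.ofReal ((1 + ε) / Real.sqrt (2 * Real.pi * (n * v)))) := by
        refine mul_le_mul_right (h5.trans (h6.trans (mul_le_mul_right ?_ _))) _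
        exact lintegral_prod_dualWeight_le hv hε1 hac hc hcc h4 hε
    _ = _ := by
        rw [← ENNReal.ofReal_pow (by positivity), ← ENNReal.ofReal_mul (by positivity),
          ← ENNReal.ofReal_mul (by have := gauss_pos (n * v) z; positivity)]
        congr 1
        rw [div_pow, div_pow, one_pow]
        ring

end

/-! ### Centred residues -/

theorem mem_Zq {q : ℕ} {x : ℤ} : x ∈ Zq q ↔ -(q : ℤ) ≤ 2 * x ∧ 2 * x < q := by
  simp only [Zq, Finset.mem_filter, Finset.mem_Icc]
  omega

theorem dvd_cmod_sub (a : ℤ) (q : ℕ) : (q : ℤ) ∣ cmod a q - a :=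
  ⟨-((2 * a + q) / (2 * q)), by unfold cmod; ring⟩

theorem eq_of_mem_Zq_of_dvd {q : ℕ} {x y : ℤ} (hx : x ∈ Zq q) (hy : y ∈ Zq q)
    (h : (q : ℤ) ∣ x - y) : x = y := by
  rw [mem_Zq] at hx hy
  have := Int.eq_zero_of_abs_lt_dvd h (by rw [abs_lt]; constructor <;> linarith)
  linarith

theorem cmod_eq_iff {q : ℕ} (hq : 0 < q) {a y : ℤ} (hy : y ∈ Zq q) :
    cmod a q = y ↔ (q : ℤ) ∣ a - y := by
  have h := dvd_cmod_sub a q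
  constructor
  · rintro rfl
    simpa using (dvd_neg.2 h)
  · intro h'
    refine eq_of_mem_Zq_of_dvd (cmod_mem_Zq a hq) hy ?_
    simpa using dvd_add h h'

theorem cmod_of_mem {q : ℕ} (hq : 0 < q) {y : ℤ} (hy : y ∈ Zq q) : cmod y q = y :=
  (cmod_eq_iff hq hy).2 (by simp)

theorem cmod_eq_cmod_iff {q : ℕ} (hq : 0 < q) {a b : ℤ} :
    cmod a q = cmod b q ↔ (q : ℤ) ∣ a - b := by
  rw [cmod_eq_iff hq (cmod_mem_Zq b hq)]
  have h := dvd_cmod_sub b q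
  constructor
  · intro h'
    simpa using dvd_add h' h
  · intro h'
    simpa using dvd_sub h' h

/-- The centred representative has least absolute value in its class. -/
theorem abs_cmod_le {q : ℕ} (hq : 0 < q) (a : ℤ) : |cmod a q| ≤ |a| := by
  by_cases ha : a ∈ Zq q
  · rw [cmod_of_mem hq ha]
  · have h := cmod_mem_Zq a hq
    rw [mem_Zq] at h ha
    rcases abs_cases a with ⟨h1, _⟩ | ⟨h1, _⟩ <;> rcases abs_cases (cmod a q) with ⟨h2, _⟩ | ⟨h2, _⟩ <;>
      omega

/-- Translations permute the residues. -/
theorem sum_Zq_cmod_sub {q : ℕ} (hq : 0 < q) (a : ℤ) (f : ℤ → ℝ) :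
    ∑ x ∈ Zq q, f (cmod (x - a) q) = ∑ x ∈ Zq q, f x := by
  refine Finset.sum_nbij' (fun x => cmod (x - a) q) (fun x => cmod (x + a) q)
    (fun x _ => cmod_mem_Zq _ hq) (fun x _ => cmod_mem_Zq _ hq) (fun x hx => ?_) (fun x hx => ?_)
    (fun _ _ => rfl)
  · rw [cmod_eq_iff hq hx]
    have := dvd_cmod_sub (x - a) q
    convert this using 1
    ring
  · rw [cmod_eq_iff hq hx]
    have := dvd_cmod_sub (x + a) q
    convert this using 1
    ring

/-! ### Discrete normal distributions on the residues -/

/-- The Gaussian mass of the residues, with centre `a`. -/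
def windowMass (q : ℕ) (v : ℝ) (a : ℤ) : ℝ := ∑ x ∈ Zq q, gauss v ((x - a : ℤ) : ℝ)

theorem zero_mem_Zq {q : ℕ} (hq : 0 < q) : (0 : ℤ) ∈ Zq q := by
  rw [mem_Zq]; omega

theorem windowMass_pos {q : ℕ} (hq : 0 < q) (v : ℝ) (a : ℤ) : 0 < windowMass q v a :=
  Finset.sum_pos (fun _ _ => gauss_pos _ _) ⟨0, zero_mem_Zq hq⟩

theorem discreteNormal_of_mem {q : ℕ} {v : ℝ} {a x : ℤ} (hx : x ∈ Zq q) :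
    discreteNormal (Zq q) a v x = gauss v ((x - a : ℤ) : ℝ) / windowMass q v a := by
  simp [discreteNormal, hx, gauss, windowMass]

theorem discreteNormal_zero_of_mem {q : ℕ} {v : ℝ} {x : ℤ} (hx : x ∈ Zq q) :
    discreteNormal (Zq q) 0 v x = gauss v x / windowMass q v 0 := by
  simpa using discreteNormal_of_mem (a := 0) (v := v) hx

theorem discreteNormal_nonneg (S : Finset ℤ) (m w : ℝ) (x : ℤ) : 0 ≤ discreteNormal S m w x := by
  unfold discreteNormal
  split_ifs
  · exact div_nonneg (Real.exp_pos _).le (Finset.sum_nonneg fun _ _ => (Real.exp_pos _).le)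
  · exact le_rfl

theorem sum_discreteNormal {S : Finset ℤ} (hS : S.Nonempty) (m w : ℝ) :
    ∑ x ∈ S, discreteNormal S m w x = 1 := by
  have h : ∀ x ∈ S, discreteNormal S m w x = Real.exp (-((x : ℝ) - m) ^ 2 / (2 * w)) /
      ∑ y ∈ S, Real.exp (-((y : ℝ) - m) ^ 2 / (2 * w)) := fun x hx => by
    simp [discreteNormal, hx]
  rw [Finset.sum_congr rfl h, ← Finset.sum_div]
  exact div_self (Finset.sum_pos (fun _ _ => Real.exp_pos _) hS).ne'

/-- Among all windows of length `q`, the centred one has the largest Gaussian mass. -/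
theorem windowMass_le {q : ℕ} (hq : 0 < q) {v : ℝ} (hv : 0 < v) (a : ℤ) :
    windowMass q v a ≤ windowMass q v 0 := by
  unfold windowMass
  simp only [sub_zero]
  rw [← sum_Zq_cmod_sub hq a fun x => gauss v x]
  refine Finset.sum_le_sum fun x _ => gauss_le_gauss hv ?_
  exact_mod_cast abs_cmod_le hq (x - a)

theorem windowMass_le_mass {q : ℕ} {v : ℝ} (hv : 0 < v) (a : ℤ) :
    windowMass q v a ≤ gaussMass v := sum_gauss_le_mass hv _ _

/-- Integers outside `Zq q` have absolute value at least `⌈q/2⌉ = (q + 1) / 2`; the factor `2`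
accounts for the sign. -/
theorem tsum_compl_Zq_le (q : ℕ) {v : ℝ} (hv : 0 < v) :
    ∑' x : {x : ℤ // x ∉ Zq q}, gauss v x ≤ 2 * gaussTail v ((q + 1) / 2) := by
  set N := (q + 1) / 2 with hN
  have hmem : ∀ x : {x : ℤ // x ∉ Zq q}, N ≤ x.1.natAbs := fun x => by
    have := x.2
    rw [mem_Zq] at this
    omega
  let i : {x : ℤ // x ∉ Zq q} → ℕ × Bool := fun x => (x.1.natAbs - N, decide (0 ≤ x.1))
  have hi : Function.Injective i := fun x y h => by
    simp only [i, Prod.mk.injEq, decide_eq_decide] at h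
    have := hmem x
    have := hmem y
    refine Subtype.ext ?_
    omega
  have hs : Summable fun p : ℕ × Bool => gauss v ((N + p.1 : ℕ) : ℝ) := by
    have := (summable_gaussTail hv N).mul_of_nonneg (g := fun _ : Bool => (1 : ℝ))
      (Summable.of_finite) (fun _ => (gauss_pos _ _).le) (fun _ => zero_le_one)
    simpa using this
  have key : ∑' x : {x : ℤ // x ∉ Zq q}, gauss v x ≤
      ∑' p : ℕ × Bool, gauss v ((N + p.1 : ℕ) : ℝ) := by
    refine Summable.tsum_le_tsum_of_inj i hi (fun _ _ => (gauss_pos _ _).le) (fun x => ?_)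
      ((summable_gauss hv).subtype _) hs
    have h1 : N + (i x).1 = x.1.natAbs := by
      have := hmem x
      simp only [i]
      omega
    rw [h1]
    refine gauss_le_gauss hv (le_of_eq ?_)
    rw [Nat.cast_natAbs, Int.cast_abs, abs_abs]
  refine key.trans (le_of_eq ?_)
  rw [hs.tsum_prod]
  simp [gaussTail, tsum_mul_left]

theorem gaussMass_le_window_add (q : ℕ) {v : ℝ} (hv : 0 < v) :
    gaussMass v ≤ windowMass q v 0 + 2 * gaussTail v ((q + 1) / 2) := by
  have h := (summable_gauss hv).sum_add_tsum_subtype_compl (Zq q)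
  have h2 := tsum_compl_Zq_le q hv
  unfold gaussMass windowMass
  simp only [sub_zero]
  rw [← h]
  gcongr

/-! ### Tails -/

section Tails

variable {n v : ℝ} {q : ℕ}

/-- The Gaussian mass of the residues of absolute value larger than `q / (2 √n)`. -/
def outerMass (q : ℕ) (n v : ℝ) : ℝ :=
  ∑ x ∈ (Zq q).filter (fun x : ℤ => (q : ℝ) / 2 < Real.sqrt n * |(x : ℝ)|), gauss v x

theorem threshold_facts (hn : 2 ≤ n) (hv : 36 * n ≤ v) (hq : 4 * n * v < (q : ℝ) ^ 2) :
    v < ((q : ℝ) / (2 * Real.sqrt n)) ^ 2 ∧ 6 ≤ (q : ℝ) / (2 * Real.sqrt n) ∧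
      Real.sqrt n * ((q : ℝ) / (2 * Real.sqrt n)) = q / 2 := by
  have hR : 0 < Real.sqrt n := Real.sqrt_pos.2 (by linarith)
  have hR2 : Real.sqrt n ^ 2 = n := Real.sq_sqrt (by linarith)
  have h1 : v < ((q : ℝ) / (2 * Real.sqrt n)) ^ 2 := by
    rw [div_pow, mul_pow, hR2, lt_div_iff₀ (by linarith)]
    linarith
  refine ⟨h1, ?_, by field_simp⟩
  have h0 : (0 : ℝ) ≤ (q : ℝ) / (2 * Real.sqrt n) := by positivity
  nlinarith

/-- Put `t = q / (2√n)`. The integers from `⌊t⌋ + 1` up to `⌈q/2⌉ - 1` are residues beyond the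
threshold, so the two tails differ by at most the outer mass. The further tail is at most `4 / (n +
3)` times the nearer one; for `n ≥ 2` this is at most `4/5`, whence the factor `5`, and multiplying
by `n` gives `20`. -/
theorem gaussTail_le_outerMass (hn : 2 ≤ n) (hv : 36 * n ≤ v) (hq : 4 * n * v < (q : ℝ) ^ 2) :
    gaussTail v (⌊(q : ℝ) / (2 * Real.sqrt n)⌋₊ + 1) ≤ 5 * outerMass q n v ∧
      n * gaussTail v ((q + 1) / 2) ≤ 20 * outerMass q n v := by
  obtain ⟨hvt, ht, hRt⟩ := threshold_facts hn hv hq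
  have hv0 : 0 < v := by linarith
  have hR : 0 < Real.sqrt n := Real.sqrt_pos.2 (by linarith)
  have hR2 : Real.sqrt n ^ 2 = n := Real.sq_sqrt (by linarith)
  set R := Real.sqrt n with hRd
  set t : ℝ := (q : ℝ) / (2 * R) with htd
  set Nt := ⌊t⌋₊ + 1 with hNt
  set Nb := (q + 1) / 2 with hNb
  have hNt1 : (Nt : ℝ) ≤ t + 1 := by
    rw [hNt]; push_cast
    linarith [Nat.floor_le (show 0 ≤ t by linarith)]
  have hNt2 : t < Nt := by
    rw [hNt]; push_cast
    exact Nat.lt_floor_add_one t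
  have hNb1 : (q : ℝ) / 2 ≤ Nb := by
    have : q ≤ 2 * Nb := by omega
    have : (q : ℝ) ≤ 2 * Nb := by exact_mod_cast this
    linarith
  have hR14 : 1.4 ≤ R := by nlinarith
  have hle : Nt ≤ Nb := by
    have : (Nt : ℝ) ≤ Nb := by nlinarith
    exact_mod_cast this
  obtain ⟨m, hm⟩ := Nat.exists_eq_add_of_le hle
  have hsum := gaussTail_eq_sum_add hv0 Nt m
  have hadd := gaussTail_add_le hv0 Nt m
  rw [← hm] at hsum
  have hm' : (Nt : ℝ) + m = Nb := by rw [hm]; push_cast; ring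
  rw [hm', ← hm] at hadd
  have hB : ∑ k ∈ Finset.range m, gauss v ((Nt + k : ℕ) : ℝ) ≤ outerMass q n v := by
    have hinj : ∀ a ∈ Finset.range m, ∀ b ∈ Finset.range m,
        ((Nt + a : ℕ) : ℤ) = ((Nt + b : ℕ) : ℤ) → a = b := fun a _ b _ h => by omega
    have h1 : ∑ k ∈ Finset.range m, gauss v ((Nt + k : ℕ) : ℝ) =
        ∑ x ∈ (Finset.range m).image (fun k => ((Nt + k : ℕ) : ℤ)), gauss v x := by
      rw [Finset.sum_image hinj]
      simp
    rw [h1]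
    refine Finset.sum_le_sum_of_subset_of_nonneg (fun x hx => ?_) fun _ _ _ => (gauss_pos _ _).le
    obtain ⟨k, hk, rfl⟩ := Finset.mem_image.1 hx
    rw [Finset.mem_range] at hk
    rw [Finset.mem_filter, mem_Zq]
    refine ⟨by omega, ?_⟩
    rw [← hRt]
    refine mul_lt_mul_of_pos_left ?_ hR
    refine lt_of_lt_of_le hNt2 (le_trans ?_ (le_abs_self _))
    push_cast
    linarith [(Nat.cast_nonneg k : (0 : ℝ) ≤ k)]
  have hexp : Real.exp (-((Nb : ℝ) ^ 2 - (Nt : ℝ) ^ 2) / (2 * v)) ≤ 4 / (n + 3) := by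
    -- With `Nb ≥ √n t` and `Nt ≤ t + 1`, the difference of squares is at least `(n - 1)t² - 2t -
    -- 1`. The loss is at most half of the main term because `t ≥ 6`, and `t² > v`.
    have h1 : (n - 1) / 4 ≤ ((Nb : ℝ) ^ 2 - (Nt : ℝ) ^ 2) / (2 * v) := by
      rw [div_le_div_iff₀ (by norm_num) (by positivity)]
      have e1 : n * t ^ 2 ≤ (Nb : ℝ) ^ 2 := by
        have : (R * t) ^ 2 ≤ (Nb : ℝ) ^ 2 := by
          rw [hRt]; gcongr
        rwa [mul_pow, hR2] at this
      have e2 : (Nt : ℝ) ^ 2 ≤ (t + 1) ^ 2 := by gcongr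
      have e3 : (n - 1) * v ≤ (n - 1) * t ^ 2 := by
        refine mul_le_mul_of_nonneg_left hvt.le (by linarith)
      have e4 : t ^ 2 ≤ (n - 1) * t ^ 2 := le_mul_of_one_le_left (by positivity) (by linarith)
      nlinarith
    have h2 : (n + 3) / 4 ≤ Real.exp ((n - 1) / 4) := by
      have := Real.add_one_le_exp ((n - 1) / 4)
      linarith
    rw [neg_div, Real.exp_neg, inv_le_comm₀ (Real.exp_pos _) (by positivity), inv_div]
    exact h2.trans (Real.exp_le_exp.2 h1)
  have hT0 := gaussTail_nonneg v Nt
  set T := gaussTail v Nt with hT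
  set A := gaussTail v Nb with hA
  have hA1 : A ≤ 4 / (n + 3) * T := hadd.trans (mul_le_mul_of_nonneg_right hexp hT0)
  rw [div_mul_eq_mul_div, le_div_iff₀ (by linarith)] at hA1
  have hA0 : 0 ≤ A := gaussTail_nonneg _ _
  have hT5 : T ≤ 5 * outerMass q n v := by nlinarith
  exact ⟨hT5, by nlinarith⟩

/-- Dividing by `√n` turns the tail of variance `n v` beyond `q / 2` into the tail of variance `v`
beyond `t = q / (2√n)`, which the outer mass controls. The factor `√n` from the blocks matches the
growth of the total mass. -/
theorem gaussTail_scaled_le {κ ε : ℝ} (hn : 2 ≤ n) (hv : 36 * n ≤ v)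
    (hq : 4 * n * v < (q : ℝ) ^ 2) (hε0 : 0 ≤ ε) (hκ : 0 ≤ κ)
    (hε : Real.exp (-(Real.pi * v / n)) ≤ ε / 2)
    (hB : outerMass q n v ≤ κ * ε * gaussMass v)
    (h4 : Real.exp (-(2 * Real.pi ^ 2 * v)) ≤ 1 / 4) :
    gaussTail (n * v) ((q + 1) / 2) ≤
      (1 + 20 * (1 + Real.exp 4) * κ) * ε * gaussMass (n * v) := by
  obtain ⟨hvt, ht, hRt⟩ := threshold_facts hn hv hq
  have hT := (gaussTail_le_outerMass hn hv hq).1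
  have hv0 : 0 < v := by linarith
  have hn0 : 0 < n := by linarith
  have hR : 0 < Real.sqrt n := Real.sqrt_pos.2 hn0
  have hR2 : Real.sqrt n ^ 2 = n := Real.sq_sqrt hn0.le
  have hR1 : 1 ≤ Real.sqrt n := Real.one_le_sqrt.2 (by linarith)
  have hmass := gaussMass_pos (v := n * v) (by positivity)
  set R := Real.sqrt n with hRd
  set t : ℝ := (q : ℝ) / (2 * R) with htd
  set Nb := (q + 1) / 2 with hNb
  have hNb1 : (q : ℝ) / 2 ≤ Nb := by
    have : q ≤ 2 * Nb := by omega
    have : (q : ℝ) ≤ 2 * Nb := by exact_mod_cast this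
    linarith
  -- Rescaling yields the tail from `⌊t⌋`, one integer before the range covered by the outer mass.
  -- For `t < 3v` consecutive weights there differ by a factor of at most `exp 4`; for `t ≥ 3v` the
  -- exponent alone exceeds `πv / n`.
  rcases le_or_gt (3 * v) t with h3 | h3
  · have h1 := gaussTail_add_le (v := n * v) (by positivity) 0 Nb
    rw [zero_add] at h1
    have h2 : Real.exp (-(((0 : ℕ) + Nb : ℝ) ^ 2 - ((0 : ℕ) : ℝ) ^ 2) / (2 * (n * v))) ≤
        Real.exp (-(Real.pi * v / n)) := by
      refine Real.exp_le_exp.2 ?_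
      rw [neg_div, neg_le_neg_iff, div_le_div_iff₀ hn0 (by positivity)]
      have e1 : n * t ^ 2 ≤ (Nb : ℝ) ^ 2 := by
        have : (R * t) ^ 2 ≤ (Nb : ℝ) ^ 2 := by
          rw [hRt]; gcongr
        rwa [mul_pow, hR2] at this
      have e2 : (3 * v) ^ 2 ≤ t ^ 2 := by gcongr
      have e3 : n * (9 * v ^ 2) ≤ (Nb : ℝ) ^ 2 := by nlinarith
      push_cast
      have e4 : Real.pi * v * (2 * (n * v)) ≤ 4 * v * (2 * (n * v)) := by
        have := Real.pi_le_four
        gcongr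
      have e5 : n * (9 * v ^ 2) * n ≤ (Nb : ℝ) ^ 2 * n := by gcongr
      have e6 : 2 * (n * v ^ 2) ≤ n * (n * v ^ 2) := by gcongr
      nlinarith
    have h5 := gaussTail_le_mass (v := n * v) (by positivity) 0
    calc _ ≤ (ε / 2) * gaussMass (n * v) := by
          refine h1.trans ?_
          exact mul_le_mul (h2.trans hε) h5 (gaussTail_nonneg _ _) (by linarith)
      _ ≤ _ := by
          refine mul_le_mul_of_nonneg_right ?_ hmass.le
          have : 0 ≤ 20 * (1 + Real.exp 4) * κ * ε := by positivity
          nlinarith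
  · have h1 := gaussTail_mul_le hv0 hR1 Nb ⌊t⌋₊ (by
      have := Nat.floor_le (show 0 ≤ t by linarith)
      calc (⌊t⌋₊ : ℝ) * R ≤ t * R := by gcongr
        _ = q / 2 := by rw [mul_comm, hRt]
        _ ≤ Nb := hNb1)
    rw [hR2] at h1
    have h2 := gaussTail_eq_sum_add hv0 ⌊t⌋₊ 1
    simp only [Finset.range_one, Finset.sum_singleton, add_zero] at h2
    have h5 := gaussTail_eq_sum_add hv0 (⌊t⌋₊ + 1) 1
    simp only [Finset.range_one, Finset.sum_singleton, add_zero] at h5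
    have h6 : gauss v (⌊t⌋₊ : ℝ) ≤ Real.exp 4 * gauss v ((⌊t⌋₊ + 1 : ℕ) : ℝ) := by
      unfold gauss
      rw [← Real.exp_add]
      refine Real.exp_le_exp.2 ?_
      have := Nat.floor_le (show 0 ≤ t by linarith)
      rw [show (4 : ℝ) = 8 * v / (2 * v) by field_simp; norm_num, ← add_div]
      gcongr
      push_cast
      nlinarith
    have h7 := gaussTail_nonneg v (⌊t⌋₊ + 1 + 1)
    have h8 : gaussTail v ⌊t⌋₊ ≤ (1 + Real.exp 4) * gaussTail v (⌊t⌋₊ + 1) := by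
      have : Real.exp 4 * gauss v ((⌊t⌋₊ + 1 : ℕ) : ℝ) ≤ Real.exp 4 * gaussTail v (⌊t⌋₊ + 1) := by
        gcongr; linarith
      linarith
    have h9 : gaussMass v ≤ 2 * Real.sqrt (2 * Real.pi * v) := by
      have := gaussMass_le hv0 h4
      have := Real.sqrt_nonneg (2 * Real.pi * v)
      nlinarith
    have h10 : R * Real.sqrt (2 * Real.pi * v) ≤ gaussMass (n * v) := by
      refine le_trans (le_of_eq ?_) (sqrt_le_gaussMass (v := n * v) (by positivity))
      rw [hRd, ← Real.sqrt_mul hn0.le]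
      congr 1
      ring
    have h11 : gaussTail v (⌊t⌋₊ + 1) ≤ 5 * (κ * ε * (2 * Real.sqrt (2 * Real.pi * v))) := by
      refine hT.trans ?_
      have : κ * ε * gaussMass v ≤ κ * ε * (2 * Real.sqrt (2 * Real.pi * v)) := by gcongr
      linarith
    calc gaussTail (n * v) Nb ≤ 2 * R * ((1 + Real.exp 4) *
          (5 * (κ * ε * (2 * Real.sqrt (2 * Real.pi * v))))) := by
          refine h1.trans (mul_le_mul_of_nonneg_left (h8.trans ?_) (by positivity))
          exact mul_le_mul_of_nonneg_left h11 (by positivity)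
      _ = 20 * (1 + Real.exp 4) * κ * ε * (R * Real.sqrt (2 * Real.pi * v)) := by ring
      _ ≤ 20 * (1 + Real.exp 4) * κ * ε * gaussMass (n * v) := by gcongr
      _ ≤ _ := by
          refine mul_le_mul_of_nonneg_right ?_ hmass.le
          nlinarith

end Tails

/-! ### The smoothing parameter of the integers -/

theorem int_mem_dualLattice (k : ℤ) : (k : ℝ) ∈ dualLattice intLattice := by
  refine ⟨?_, ?_⟩
  · have h1 : (1 : ℝ) ∈ Submodule.span ℝ (intLattice : Set ℝ) :=
      Submodule.subset_span ⟨1, by simp⟩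
    simpa using Submodule.smul_mem _ (k : ℝ) h1
  · rintro x ⟨m, rfl⟩
    exact ⟨k * m, by simp⟩

theorem exists_int_of_mem_dualLattice {w : ℝ} (hw : w ∈ dualLattice intLattice) :
    ∃ k : ℤ, w = k := by
  obtain ⟨k, hk⟩ := hw.2 1 ⟨1, by simp⟩
  exact ⟨k, by simpa using hk⟩

/-- The Gaussian sum over the nonzero dual lattice vectors in the definition of
`smoothingParameter intLattice`. -/
def smoothingSum (s : ℝ) : ℝ≥0∞ :=
  ∑' w : {w : ℝ // w ∈ dualLattice intLattice ∧ w ≠ 0},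
    ENNReal.ofReal (Real.exp (-Real.pi * (s * ‖(w : ℝ)‖) ^ 2))

/-- The dual vectors `1` and `-1` already contribute this much. -/
theorem two_exp_le_smoothingSum (s : ℝ) :
    ENNReal.ofReal (2 * Real.exp (-Real.pi * s ^ 2)) ≤ smoothingSum s := by
  classical
  let w1 : {w : ℝ // w ∈ dualLattice intLattice ∧ w ≠ 0} :=
    ⟨1, by simpa using int_mem_dualLattice 1, one_ne_zero⟩
  let w2 : {w : ℝ // w ∈ dualLattice intLattice ∧ w ≠ 0} :=
    ⟨-1, by simpa using int_mem_dualLattice (-1), by norm_num⟩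
  have hne : w1 ≠ w2 := fun h => by
    have := congrArg Subtype.val h
    simp only [w1, w2] at this
    norm_num at this
  have h := ENNReal.sum_le_tsum (f := fun w : {w : ℝ // w ∈ dualLattice intLattice ∧ w ≠ 0} =>
    ENNReal.ofReal (Real.exp (-Real.pi * (s * ‖(w : ℝ)‖) ^ 2))) {w1, w2}
  rw [Finset.sum_pair hne] at h
  simp only [w1, w2, norm_neg, norm_one, mul_one] at h
  rwa [← ENNReal.ofReal_add (Real.exp_pos _).le (Real.exp_pos _).le, ← two_mul] at h

/-- For `s ≥ 1` and a nonzero integer `k`, `(s² - 1)(k² - 1) ≥ 0` separates a decaying factor from a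
convergent sum. This serves to show that some `s` meets the smoothing condition. -/
theorem smoothingSum_le {s : ℝ} (hs : 1 ≤ s) :
    smoothingSum s ≤ ENNReal.ofReal (Real.exp (-Real.pi * (s ^ 2 - 1)) *
      ∑' k : ℤ, Real.exp (-Real.pi * (k : ℝ) ^ 2)) := by
  have hsum : Summable fun k : ℤ => Real.exp (-Real.pi * (k : ℝ) ^ 2) := by
    have h := summable_pow_mul_jacobiTheta₂_term_bound 0 (T := 1) one_pos 0
    refine h.congr fun m => ?_
    simp
  rw [ENNReal.ofReal_mul (Real.exp_pos _).le,
    ENNReal.ofReal_tsum_of_nonneg (fun _ => (Real.exp_pos _).le) hsum, ← ENNReal.tsum_mul_left]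
  choose g hg using fun w : {w : ℝ // w ∈ dualLattice intLattice ∧ w ≠ 0} =>
    exists_int_of_mem_dualLattice w.2.1
  have hginj : Function.Injective g := fun a b h => by
    refine Subtype.ext ?_
    rw [hg a, hg b, h]
  refine le_trans ?_ (ENNReal.tsum_comp_le_tsum_of_injective hginj _)
  refine ENNReal.tsum_le_tsum fun w => ?_
  rw [← ENNReal.ofReal_mul (Real.exp_pos _).le, ← Real.exp_add]
  refine ENNReal.ofReal_le_ofReal (Real.exp_le_exp.2 ?_)
  have h0 : g w ≠ 0 := fun h => w.2.2 (by rw [hg w, h]; simp)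
  have h1 : (1 : ℝ) ≤ (g w : ℝ) ^ 2 := by
    have : 1 ≤ (g w) ^ 2 := by
      have := sq_pos_of_ne_zero h0
      omega
    exact_mod_cast this
  rw [mul_pow, Real.norm_eq_abs, sq_abs, hg w]
  have h2 : 0 ≤ (s ^ 2 - 1) * ((g w : ℝ) ^ 2 - 1) := mul_nonneg (by nlinarith) (by linarith)
  nlinarith [Real.pi_pos]

theorem le_smoothingParameter {ε : ℝ} (hε : 0 < ε) (hε1 : ε < 1) :
    Real.sqrt (Real.log (2 / ε) / Real.pi) ≤ smoothingParameter intLattice ε := by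
  -- Nonemptiness has to be proved: the infimum of the empty set of reals is `0` by convention.
  refine le_csInf ?_ ?_
  · set D := ∑' k : ℤ, Real.exp (-Real.pi * (k : ℝ) ^ 2) with hD
    have hlim : Filter.Tendsto (fun s : ℝ => Real.exp (-Real.pi * (s ^ 2 - 1)) * D)
        Filter.atTop (nhds 0) := by
      have h1 : Filter.Tendsto (fun s : ℝ => s ^ 2 - 1) Filter.atTop Filter.atTop :=
        Filter.tendsto_atTop_add_const_right _ _ (Filter.tendsto_pow_atTop two_ne_zero)
      have h2 : Filter.Tendsto (fun s : ℝ => -Real.pi * (s ^ 2 - 1)) Filter.atTop Filter.atBot :=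
        h1.const_mul_atTop_of_neg (by linarith [Real.pi_pos])
      simpa using (Real.tendsto_exp_atBot.comp h2).mul_const D
    obtain ⟨s, hs1, hs2⟩ := ((hlim.eventually (gt_mem_nhds hε)).and
      (Filter.eventually_ge_atTop 1)).exists
    exact ⟨s, by linarith, (smoothingSum_le hs2).trans (ENNReal.ofReal_le_ofReal hs1.le)⟩
  · rintro s ⟨hs0, hs⟩
    have h1 := (two_exp_le_smoothingSum s).trans hs
    rw [ENNReal.ofReal_le_ofReal_iff hε.le] at h1
    refine (Real.sqrt_le_left hs0.le).2 ?_
    rw [div_le_iff₀ Real.pi_pos, Real.log_le_iff_le_exp (by positivity), div_le_iff₀ hε]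
    have h2 : Real.exp (s ^ 2 * Real.pi) * Real.exp (-Real.pi * s ^ 2) = 1 := by
      rw [← Real.exp_add, ← Real.exp_zero]
      congr 1
      ring
    calc 2 = Real.exp (s ^ 2 * Real.pi) * (2 * Real.exp (-Real.pi * s ^ 2)) := by linarith
      _ ≤ _ := by gcongr

theorem exp_le_of_smoothing {ε n v : ℝ} (hε : 0 < ε) (hε1 : ε < 1) (hn : 0 < n)
    (h : n * smoothingParameter intLattice ε ^ 2 ≤ v) :
    Real.exp (-(Real.pi * v / n)) ≤ ε / 2 := by
  have hlog : 0 ≤ Real.log (2 / ε) := Real.log_nonneg (by rw [le_div_iff₀ hε]; linarith)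
  have h1 := pow_le_pow_left₀ (Real.sqrt_nonneg _) (le_smoothingParameter hε hε1) 2
  rw [Real.sq_sqrt (by have := Real.pi_pos; positivity), div_le_iff₀ Real.pi_pos] at h1
  have h2 : Real.log (2 / ε) ≤ Real.pi * v / n := by
    rw [le_div_iff₀ hn]
    nlinarith [Real.pi_pos]
  have h3 : Real.exp (-(Real.pi * v / n)) ≤ Real.exp (-Real.log (2 / ε)) := by gcongr
  rwa [Real.exp_neg (Real.log _), Real.exp_log (by positivity), inv_div] at h3

section

variable {ι : Type*} [Fintype ι]

/-! ### The filtered noise -/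

/-- Restricting an inner product to the support of its first argument. -/
theorem dotProduct_support (c x : ι → ℤ) (b : ι → ℤ) (hb : ∀ j, c j = 0 → b j * x j = 0) :
    b ⬝ᵥ x = (fun j : {j // c j ≠ 0} => b j) ⬝ᵥ (fun j : {j // c j ≠ 0} => x j) := by
  classical
  simp only [dotProduct]
  rw [← Finset.sum_filter_of_ne (p := fun j => c j ≠ 0) fun j _ h hc => h (hb j hc)]
  exact Finset.sum_subtype _ (by simp) fun j => b j * x j

theorem eq_single_of_dotProduct_self_eq_one [DecidableEq ι] {c : ι → ℤ} (h : c ⬝ᵥ c = 1) :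
    ∃ i, c = Pi.single i 1 ∨ c = Pi.single i (-1) := by
  have hne : ∃ i, c i ≠ 0 := by
    by_contra! h0
    simp [dotProduct, h0] at h
  obtain ⟨i, hi⟩ := hne
  have h1 : 1 ≤ c i * c i := by
    have := mul_self_pos.2 hi
    omega
  have h2 : c i * c i + ∑ j ∈ Finset.univ.erase i, c j * c j = 1 := by
    rw [← h, dotProduct]
    exact Finset.add_sum_erase Finset.univ (fun j => c j * c j) (Finset.mem_univ i)
  have h3 : ∀ j, j ≠ i → c j = 0 := fun j hj => by
    have h4 := Finset.single_le_sum (f := fun j => c j * c j) (fun j _ => mul_self_nonneg _)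
      (Finset.mem_erase.2 ⟨hj, Finset.mem_univ j⟩)
    have h5 : c j * c j = 0 := le_antisymm (by linarith) (mul_self_nonneg _)
    exact mul_self_eq_zero.1 h5
  have h6 : c i * c i = 1 := by
    have : ∑ j ∈ Finset.univ.erase i, c j * c j = 0 :=
      Finset.sum_eq_zero fun j hj => by simp [h3 j (Finset.mem_erase.1 hj).1]
    linarith
  refine ⟨i, ?_⟩
  rcases mul_self_eq_one_iff.1 h6 with h7 | h7
  · left
    funext j
    by_cases hj : j = i
    · subst hj; simp [h7]
    · simp [hj, h3 j hj]
  · right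
    funext j
    by_cases hj : j = i
    · subst hj; simp [h7]
    · simp [hj, h3 j hj]

/-- The constant in the bound for the law of the filtered noise. -/
def lawConst (κ : ℝ) : ℝ := 40 * κ * Real.exp (40 * κ) + 3 + 3 * (40 * κ * Real.exp (40 * κ))

/-- The constant in the bound for the tail of the filtered noise. -/
def tailConst (κ : ℝ) : ℝ := 1 + 20 * (1 + Real.exp 4) * κ

theorem lawConst_pos {κ : ℝ} (hκ : 0 < κ) : 0 < lawConst κ := by
  unfold lawConst; positivity

theorem tailConst_pos {κ : ℝ} (hκ : 0 < κ) : 0 < tailConst κ := by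
  unfold tailConst; positivity

/-- The hypotheses on the noise: independent discrete normal variables on the residues with a
variance parameter between the smoothing bound and the modulus, and a primitive linear form. -/
structure NoiseData {Ω : Type*} [MeasurableSpace Ω] (μ : Measure Ω) (e : ι → Ω → ℤ) (c : ι → ℤ)
    (q : ℕ) (v ε κ : ℝ) : Prop where
  q_pos : 0 < q
  ε_pos : 0 < ε
  ε_lt_one : ε < 1
  κ_pos : 0 < κ
  meas : ∀ j, Measurable (e j)
  indep : iIndepFun e μ
  law : ∀ j (x : ℤ), μ.real {ω | e j ω = x} = discreteNormal (Zq q) 0 v x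
  gcd : Finset.univ.gcd c = 1
  large : 36 * ((c ⬝ᵥ c : ℤ) : ℝ) ≤ v
  upper : 4 * ((c ⬝ᵥ c : ℤ) : ℝ) * v < (q : ℝ) ^ 2
  smooth : Real.exp (-(Real.pi * v / ((c ⬝ᵥ c : ℤ) : ℝ))) ≤ ε / 2
  outer : outerMass q ((c ⬝ᵥ c : ℤ) : ℝ) v ≤ κ * ε * windowMass q v 0

/-! ### Domination of the law of the filtered noise by a discrete normal law -/

namespace NoiseData

variable {Ω : Type*} [MeasurableSpace Ω] {μ : Measure Ω} [IsProbabilityMeasure μ]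
  {e : ι → Ω → ℤ} {c : ι → ℤ} {q : ℕ} {v ε κ : ℝ} (D : NoiseData μ e c q v ε κ)

include D

theorem dotProduct_self_pos : 0 < c ⬝ᵥ c := by
  obtain ⟨i, -, hi⟩ := Finset.gcd_ne_zero_iff.1 (by rw [D.gcd]; exact one_ne_zero)
  refine lt_of_lt_of_le (mul_self_pos.2 hi) ?_
  exact Finset.single_le_sum (f := fun i => c i * c i) (fun j _ => mul_self_nonneg _)
    (Finset.mem_univ i)

theorem one_le_norm : (1 : ℝ) ≤ ((c ⬝ᵥ c : ℤ) : ℝ) := by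
  exact_mod_cast D.dotProduct_self_pos

theorem variance_pos : 0 < v := by linarith [D.large, D.one_le_norm]

theorem law_le (j : ι) (x : ℤ) : μ.real {ω | e j ω = x} ≤ gauss v x / windowMass q v 0 := by
  rw [D.law]
  by_cases hx : x ∈ Zq q
  · rw [discreteNormal_zero_of_mem hx]
  · rw [discreteNormal, if_neg hx]
    exact div_nonneg (gauss_pos _ _).le (windowMass_pos D.q_pos _ _).le

theorem exp_dual_le : Real.exp (-(2 * Real.pi ^ 2 * v)) ≤ 1 / 4 ∧
    3 * Real.exp (-(2 * Real.pi ^ 2 * (((c ⬝ᵥ c : ℤ) : ℝ) * v))) ≤ ε ∧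
    Real.exp (-(2 * Real.pi ^ 2 * (((c ⬝ᵥ c : ℤ) : ℝ) * v))) ≤ 1 / 4 ∧
    Real.exp (-(Real.pi * v / ((c ⬝ᵥ c : ℤ) : ℝ))) ≤ 1 / 4 := by
  have hn := D.one_le_norm
  have hv := D.variance_pos
  have hlarge := D.large
  have hsmooth := D.smooth
  set n := ((c ⬝ᵥ c : ℤ) : ℝ)
  have hpi := Real.pi_gt_three
  have hquarter : ∀ x : ℝ, 3 ≤ x → Real.exp (-x) ≤ 1 / 4 := fun x hx => by
    rw [Real.exp_neg, inv_le_comm₀ (Real.exp_pos _) (by norm_num)]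
    have := Real.add_one_le_exp x
    linarith
  have hx : 3 ≤ Real.pi * v / n := by
    rw [le_div_iff₀ (by linarith)]
    nlinarith
  have hxv : Real.pi * v / n ≤ Real.pi * v := div_le_self (by positivity) hn
  have hnv : v ≤ n * v := le_mul_of_one_le_left hv.le hn
  have h1 : Real.pi * v * 2 ≤ 2 * Real.pi ^ 2 * v := by nlinarith [mul_pos Real.pi_pos hv]
  have h2 : 2 * Real.pi ^ 2 * v ≤ 2 * Real.pi ^ 2 * (n * v) := by gcongr
  refine ⟨hquarter _ (by linarith), ?_, hquarter _ (by linarith), hquarter _ hx⟩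
  have h3 : Real.exp (-(2 * Real.pi ^ 2 * (n * v))) ≤
      Real.exp (-(Real.pi * v / n)) * Real.exp (-(Real.pi * v / n)) := by
    rw [← Real.exp_add]
    refine Real.exp_le_exp.2 (by linarith)
  have h4 := hquarter _ hx
  have h5 : Real.exp (-(Real.pi * v / n)) * Real.exp (-(Real.pi * v / n)) ≤ 1 / 4 * (ε / 2) := by
    gcongr
  linarith [D.ε_pos]

/-- The tail outside the window is `O(ε / n)` relative to the window, so each factor is at most `1 +
40κε / n`, and at most `n` factors multiply to at most `exp(40κε)`. The last step is `exp y ≤ 1 + y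
exp y`. -/
theorem window_ratio_le (hn2 : 2 ≤ ((c ⬝ᵥ c : ℤ) : ℝ)) {M : ℕ}
    (hM : (M : ℝ) ≤ ((c ⬝ᵥ c : ℤ) : ℝ)) :
    (Real.sqrt (2 * Real.pi * v) / windowMass q v 0) ^ M ≤
      1 + 40 * κ * Real.exp (40 * κ) * ε := by
  have hv := D.variance_pos
  have hZ := windowMass_pos D.q_pos v 0
  have hε := D.ε_pos
  have hκ := D.κ_pos
  have htail := (gaussTail_le_outerMass hn2 D.large D.upper).2
  have houter := D.outer
  set n := ((c ⬝ᵥ c : ℤ) : ℝ)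
  set Z := windowMass q v 0
  set A := gaussTail v ((q + 1) / 2)
  have h1 : Real.sqrt (2 * Real.pi * v) / Z ≤ 1 + 40 * κ * ε / n := by
    rw [div_le_iff₀ hZ]
    have h2 := (sqrt_le_gaussMass hv).trans (gaussMass_le_window_add q hv)
    have h3 : 2 * A ≤ 40 * κ * ε / n * Z := by
      rw [div_mul_eq_mul_div, le_div_iff₀ (by linarith)]
      linarith
    linarith
  have h2 : (Real.sqrt (2 * Real.pi * v) / Z) ^ M ≤ Real.exp (40 * κ * ε) := by
    calc _ ≤ (Real.exp (40 * κ * ε / n)) ^ M := by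
          refine pow_le_pow_left₀ (by positivity) (h1.trans ?_) _
          linarith [Real.add_one_le_exp (40 * κ * ε / n)]
      _ = Real.exp (M * (40 * κ * ε / n)) := by rw [Real.exp_nat_mul]
      _ ≤ _ := by
          refine Real.exp_le_exp.2 ?_
          rw [mul_div_assoc', div_le_iff₀ (by linarith), mul_comm]
          exact mul_le_mul_of_nonneg_left hM (by positivity)
  refine h2.trans ?_
  set y := 40 * κ * ε
  have h3 : Real.exp y * (1 - y) ≤ 1 := by
    have := Real.add_one_le_exp (-y)
    calc Real.exp y * (1 - y) ≤ Real.exp y * Real.exp (-y) := by gcongr; linarith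
      _ = 1 := by rw [← Real.exp_add, add_neg_cancel, Real.exp_zero]
  have h4 : y * Real.exp y ≤ y * Real.exp (40 * κ) := by
    have : y ≤ 40 * κ := mul_le_of_le_one_right (by positivity) D.ε_lt_one.le
    gcongr
  calc Real.exp y ≤ 1 + y * Real.exp y := by linarith
    _ ≤ 1 + y * Real.exp (40 * κ) := by linarith
    _ = _ := by simp only [y]; ring

theorem law_linearForm_le_mass (hn2 : 2 ≤ ((c ⬝ᵥ c : ℤ) : ℝ)) (z : ℤ) :
    μ.real {ω | c ⬝ᵥ (fun j => e j ω) = z} * gaussMass (((c ⬝ᵥ c : ℤ) : ℝ) * v) ≤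
      (1 + lawConst κ * ε) * gauss (((c ⬝ᵥ c : ℤ) : ℝ) * v) z := by
  classical
  have hv := D.variance_pos
  have hε := D.ε_pos
  have hκ := D.κ_pos
  have hZ := windowMass_pos D.q_pos v 0
  have hcc0 := D.dotProduct_self_pos
  obtain ⟨-, hd1, hd2, h4⟩ := D.exp_dual_le
  obtain ⟨a, ha⟩ := Finset.gcd_eq_sum_mul Finset.univ c
  -- Passing to the support of `c` loses nothing in the inner product. It provides the nonzero
  -- entries required for the minors and bounds the number of factors by `n`, each entry
  -- contributing at least `1` to `c ⬝ᵥ c`.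
  let c' : {j // c j ≠ 0} → ℤ := fun j => c j
  let a' : {j // c j ≠ 0} → ℤ := fun j => a j
  let e' : {j // c j ≠ 0} → Ω → ℤ := fun j => e j
  have hac : a' ⬝ᵥ c' = 1 := by
    rw [← dotProduct_support c c a fun j hj => by simp [hj]]
    rw [← D.gcd, ha, dotProduct]
    exact Finset.sum_congr rfl fun j _ => by ring
  have hcc : c' ⬝ᵥ c' = c ⬝ᵥ c := (dotProduct_support c c c fun j hj => by simp [hj]).symm
  have hce : ∀ ω, c ⬝ᵥ (fun j => e j ω) = c' ⬝ᵥ (fun j => e' j ω) := fun ω =>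
    dotProduct_support c _ c fun j hj => by simp [hj]
  have hind : iIndepFun e' μ := D.indep.precomp Subtype.val_injective
  have hM : (Fintype.card {j // c j ≠ 0} : ℝ) ≤ ((c ⬝ᵥ c : ℤ) : ℝ) := by
    have : (Fintype.card {j // c j ≠ 0} : ℤ) ≤ c ⬝ᵥ c := by
      rw [← hcc, dotProduct]
      have := Finset.card_nsmul_le_sum Finset.univ (fun j => c' j * c' j) 1 fun j _ => by
        have := mul_self_pos.2 j.2
        simp only [c']
        omega
      simpa using this
    exact_mod_cast this
  have hmain := measure_linearForm_le (c := c') (a := a') (Y := e') (fun j => D.meas j) hind hv hZ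
    hε.le D.ε_lt_one.le (fun j x => D.law_le j x) hac (fun j => j.2) (by rw [hcc]; exact hcc0)
    (by rw [hcc]; exact h4) (by rw [hcc]; exact D.smooth) z
  simp_rw [hce]
  rw [hcc] at hmain
  have hratio := D.window_ratio_le hn2 hM
  set n := ((c ⬝ᵥ c : ℤ) : ℝ)
  have hmass := gaussMass_le (v := n * v) (by positivity) hd2
  have hs : 0 < Real.sqrt (2 * Real.pi * (n * v)) := Real.sqrt_pos.2 (by positivity)
  have hG := gauss_pos (n * v) z
  set s := Real.sqrt (2 * Real.pi * (n * v))
  set r := (Real.sqrt (2 * Real.pi * v) / windowMass q v 0) ^ Fintype.card {j // c j ≠ 0}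
  have hr : 0 ≤ r := by positivity
  set E := 40 * κ * Real.exp (40 * κ) with hE
  have hE0 : 0 ≤ E := by positivity
  have hmass0 := gaussMass_pos (v := n * v) (by positivity)
  have hm2 : gaussMass (n * v) ≤ s * (1 + ε) := hmass.trans (by gcongr)
  calc _ ≤ (r * ((1 + ε) / s) * gauss (n * v) z) * gaussMass (n * v) := by gcongr
    _ ≤ ((1 + E * ε) * ((1 + ε) / s) * gauss (n * v) z) * (s * (1 + ε)) := by gcongr
    _ = (1 + E * ε) * (1 + ε) ^ 2 * gauss (n * v) z := by field_simp
    _ ≤ _ := by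
        refine mul_le_mul_of_nonneg_right ?_ hG.le
        have h1 : (1 + ε) ^ 2 ≤ 1 + 3 * ε := by nlinarith [D.ε_lt_one]
        have h2 : E * ε * ε ≤ E * ε := mul_le_of_le_one_right (by positivity) D.ε_lt_one.le
        have h3 : (1 + E * ε) * (1 + ε) ^ 2 ≤ (1 + E * ε) * (1 + 3 * ε) := by gcongr
        have h5 : lawConst κ = E + 3 + 3 * E := rfl
        rw [h5]
        nlinarith

theorem norm_eq_one_or : c ⬝ᵥ c = 1 ∨ 2 ≤ ((c ⬝ᵥ c : ℤ) : ℝ) := by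
  have := D.dotProduct_self_pos
  rcases eq_or_lt_of_le (show 1 ≤ c ⬝ᵥ c by omega) with h | h
  · exact Or.inl h.symm
  · right
    exact_mod_cast h

theorem exists_sign (h : c ⬝ᵥ c = 1) : ∃ i, (∀ ω, c ⬝ᵥ (fun j => e j ω) = e i ω) ∨
    ∀ ω, c ⬝ᵥ (fun j => e j ω) = -e i ω := by
  classical
  obtain ⟨i, hi | hi⟩ := eq_single_of_dotProduct_self_eq_one h
  · exact ⟨i, Or.inl fun ω => by rw [hi]; simp⟩
  · exact ⟨i, Or.inr fun ω => by rw [hi]; simp⟩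

/-- The law of the filtered noise is dominated by the normal distribution on every window. -/
theorem law_linearForm_le (z a : ℤ) :
    μ.real {ω | c ⬝ᵥ (fun j => e j ω) = z} * windowMass q (((c ⬝ᵥ c : ℤ) : ℝ) * v) a ≤
      (1 + lawConst κ * ε) * gauss (((c ⬝ᵥ c : ℤ) : ℝ) * v) z := by
  have hv := D.variance_pos
  rcases D.norm_eq_one_or with h | h
  · have hle : μ.real {ω | c ⬝ᵥ (fun j => e j ω) = z} ≤ gauss v z / windowMass q v 0 := by
      obtain ⟨i, hi | hi⟩ := D.exists_sign h
      · simp_rw [hi]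
        exact D.law_le i z
      · simp_rw [hi, neg_eq_iff_eq_neg]
        have := D.law_le i (-z)
        rwa [Int.cast_neg, gauss_neg] at this
    rw [h, Int.cast_one, one_mul]
    have hZ := windowMass_pos D.q_pos v 0
    have hG := gauss_pos v z
    calc _ ≤ gauss v z / windowMass q v 0 * windowMass q v 0 :=
          mul_le_mul hle (windowMass_le D.q_pos hv a) (windowMass_pos D.q_pos _ _).le (by positivity)
      _ = gauss v z := by field_simp
      _ ≤ _ := by
          refine le_mul_of_one_le_left hG.le ?_
          have := mul_pos (lawConst_pos D.κ_pos) D.ε_pos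
          linarith
  · refine le_trans ?_ (D.law_linearForm_le_mass h z)
    have hn := D.one_le_norm
    exact mul_le_mul_of_nonneg_left (windowMass_le_mass (by positivity) a) measureReal_nonneg

theorem measurable_linearForm : Measurable fun ω => c ⬝ᵥ (fun j => e j ω) := by
  have h : Measurable fun ω j => e j ω := measurable_pi_lambda _ D.meas
  exact (Measurable.of_discrete (f := fun x : ι → ℤ => c ⬝ᵥ x)).comp h

/-- Summing the pointwise domination over the complement of the residues leaves a Gaussian tail of
variance `n v`, which is `O(ε)` of the total mass. -/
theorem measure_linearForm_compl_le (hn2 : 2 ≤ ((c ⬝ᵥ c : ℤ) : ℝ)) :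
    μ.real {ω | c ⬝ᵥ (fun j => e j ω) ∉ Zq q} ≤
      (1 + lawConst κ) * (2 * tailConst κ) * ε := by
  have hv := D.variance_pos
  have hε := D.ε_pos
  have hκ := D.κ_pos
  have hn := D.one_le_norm
  have hlaw := D.law_linearForm_le_mass hn2
  have hL := lawConst_pos hκ
  have hB : outerMass q ((c ⬝ᵥ c : ℤ) : ℝ) v ≤ κ * ε * gaussMass v :=
    D.outer.trans (mul_le_mul_of_nonneg_left (windowMass_le_mass hv 0) (by positivity))
  have htail := gaussTail_scaled_le hn2 D.large D.upper hε.le hκ.le D.smooth hB D.exp_dual_le.1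
  set n := ((c ⬝ᵥ c : ℤ) : ℝ)
  have hnv : 0 < n * v := by positivity
  have hmass := gaussMass_pos hnv
  set m := gaussMass (n * v)
  have hcompl := tsum_compl_Zq_le q hnv
  have hLε : 0 ≤ 1 + lawConst κ * ε := by positivity
  refine ENNReal.toReal_le_of_le_ofReal (by have := tailConst_pos hκ; positivity) ?_
  have hsub : {ω | c ⬝ᵥ (fun j => e j ω) ∉ Zq q} ⊆
      ⋃ z : {z : ℤ // z ∉ Zq q}, {ω | c ⬝ᵥ (fun j => e j ω) = z} := fun ω hω =>
    Set.mem_iUnion.2 ⟨⟨_, hω⟩, rfl⟩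
  have hs : Summable fun z : {z : ℤ // z ∉ Zq q} => gauss (n * v) z := (summable_gauss hnv).subtype _
  calc μ {ω | c ⬝ᵥ (fun j => e j ω) ∉ Zq q}
      ≤ ∑' z : {z : ℤ // z ∉ Zq q}, μ {ω | c ⬝ᵥ (fun j => e j ω) = z} :=
        (measure_mono hsub).trans (measure_iUnion_le _)
    _ ≤ ∑' z : {z : ℤ // z ∉ Zq q}, ENNReal.ofReal ((1 + lawConst κ * ε) / m * gauss (n * v) z) := by
        refine ENNReal.tsum_le_tsum fun z => ?_
        rw [← ofReal_measureReal]
        refine ENNReal.ofReal_le_ofReal ?_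
        rw [div_mul_eq_mul_div, le_div_iff₀ hmass]
        exact hlaw z
    _ = ENNReal.ofReal ((1 + lawConst κ * ε) / m * ∑' z : {z : ℤ // z ∉ Zq q}, gauss (n * v) z) := by
        rw [← tsum_mul_left, ENNReal.ofReal_tsum_of_nonneg (fun z => ?_) (hs.mul_left _)]
        exact mul_nonneg (div_nonneg hLε hmass.le) (gauss_pos _ _).le
    _ ≤ _ := by
        refine ENNReal.ofReal_le_ofReal ?_
        have h1 : ∑' z : {z : ℤ // z ∉ Zq q}, gauss (n * v) z ≤ 2 * (tailConst κ * ε * m) := by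
          refine hcompl.trans ?_
          unfold tailConst
          linarith
        have h2 : 1 + lawConst κ * ε ≤ 1 + lawConst κ := by nlinarith [D.ε_lt_one]
        calc _ ≤ (1 + lawConst κ) / m * (2 * (tailConst κ * ε * m)) := by
              gcongr
              exact tsum_nonneg fun _ => (gauss_pos _ _).le
          _ = _ := by field_simp

/-- For `n = 1` the form is a signed coordinate, whose law is known exactly. For `n ≥ 2` reduction
modulo `q` matters only off the residues, an event of probability `O(ε)`. -/
theorem measure_cmod_linearForm_le {S : Finset ℤ} (hS : S ⊆ Zq q) :
    μ.real {ω | cmod (c ⬝ᵥ (fun j => e j ω)) q ∈ S} ≤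
      ∑ y ∈ S, discreteNormal (Zq q) 0 (((c ⬝ᵥ c : ℤ) : ℝ) * v) y +
        (lawConst κ + (1 + lawConst κ) * (2 * tailConst κ)) * ε := by
  have hv := D.variance_pos
  have hε := D.ε_pos
  have hκ := D.κ_pos
  have hL := lawConst_pos hκ
  have hT := tailConst_pos hκ
  have hn := D.one_le_norm
  have hmeas := D.measurable_linearForm
  have hsum : ∀ f : Ω → ℤ, μ.real {ω | f ω ∈ S} ≤ ∑ y ∈ S, μ.real {ω | f ω = y} := fun f => by
    refine le_trans (measureReal_mono (fun ω hω => ?_) (measure_ne_top _ _))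
      (measureReal_biUnion_finset_le S _)
    exact Set.mem_biUnion hω rfl
  rcases D.norm_eq_one_or with h | h
  · have hpt : ∀ y ∈ S, μ.real {ω | cmod (c ⬝ᵥ (fun j => e j ω)) q = y} ≤
        discreteNormal (Zq q) 0 v y := fun y hy => by
      have hyq := hS hy
      have hnull : ∀ i, μ.real {ω | e i ω ∉ Zq q} = 0 := fun i => by
        have h1 : μ.real {ω | e i ω ∈ Zq q} = 1 := by
          have : {ω | e i ω ∈ Zq q} = e i ⁻¹' (Zq q : Set ℤ) := rfl
          rw [this, ← sum_measureReal_preimage_singleton _ fun y _ =>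
            D.meas i (measurableSet_singleton y), ← sum_discreteNormal ⟨0, zero_mem_Zq D.q_pos⟩ 0 v]
          exact Finset.sum_congr rfl fun x _ => D.law i x
        have h2 := measureReal_compl (μ := μ) (s := {ω | e i ω ∈ Zq q})
          (D.meas i MeasurableSet.of_discrete)
        rw [h1, probReal_univ, sub_self] at h2
        exact h2
      have hred : ∀ i (w : ℤ), w ∈ Zq q → (∀ ω, e i ω ∈ Zq q →
          cmod (c ⬝ᵥ (fun j => e j ω)) q = y → e i ω = w) →
          μ.real {ω | cmod (c ⬝ᵥ (fun j => e j ω)) q = y} ≤ discreteNormal (Zq q) 0 v w :=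
        fun i w _ hw => by
          rw [← D.law i w, ← add_zero (μ.real {ω | e i ω = w}), ← hnull i]
          refine le_trans (measureReal_mono fun ω hω => ?_) (measureReal_union_le _ _)
          by_cases hi : e i ω ∈ Zq q
          · exact Or.inl (hw ω hi hω)
          · exact Or.inr hi
      obtain ⟨i, hi | hi⟩ := D.exists_sign h
      · refine hred i y hyq fun ω hω h' => ?_
        rwa [hi, cmod_of_mem D.q_pos hω] at h'
      · have hw := cmod_mem_Zq (-y) D.q_pos
        refine (hred i _ hw fun ω hω h' => ?_).trans ?_
        · rw [hi, cmod_eq_iff D.q_pos hyq] at h'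
          symm
          rw [cmod_eq_iff D.q_pos hω]
          convert h' using 1
          ring
        · rw [discreteNormal_zero_of_mem hw, discreteNormal_zero_of_mem hyq]
          refine div_le_div_of_nonneg_right ?_ (windowMass_pos D.q_pos _ _).le
          have h1 : y = cmod (-cmod (-y) q) q := by
            symm
            rw [cmod_eq_iff D.q_pos hyq]
            rw [show -cmod (-y) q - y = -(cmod (-y) q - -y) by ring, dvd_neg]
            exact dvd_cmod_sub (-y) q
          -- Reduction does not increase absolute values, and `y` is the reduction of `-cmod (-y)
          -- q`. This also covers the residue `-q/2` for even `q`, which is its own negative.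
          have h2 : |y| ≤ |cmod (-y) q| := by
            have := abs_cmod_le D.q_pos (-cmod (-y) q)
            rwa [← h1, abs_neg] at this
          exact gauss_le_gauss hv (by exact_mod_cast h2)
    refine (hsum _).trans ?_
    rw [h, Int.cast_one, one_mul]
    refine (Finset.sum_le_sum hpt).trans (le_add_of_nonneg_right (by positivity))
  · have h1 : μ.real {ω | cmod (c ⬝ᵥ (fun j => e j ω)) q ∈ S} ≤
        μ.real {ω | c ⬝ᵥ (fun j => e j ω) ∈ S} + μ.real {ω | c ⬝ᵥ (fun j => e j ω) ∉ Zq q} := by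
      refine le_trans (measureReal_mono fun ω hω => ?_) (measureReal_union_le _ _)
      by_cases hi : c ⬝ᵥ (fun j => e j ω) ∈ Zq q
      · left
        rwa [Set.mem_ofPred_eq, cmod_of_mem D.q_pos hi] at hω
      · exact Or.inr hi
    have h2 := D.measure_linearForm_compl_le h
    set g := ∑ y ∈ S, discreteNormal (Zq q) 0 (((c ⬝ᵥ c : ℤ) : ℝ) * v) y with hg
    have hg1 : g ≤ 1 := by
      rw [← sum_discreteNormal ⟨0, zero_mem_Zq D.q_pos⟩ 0 (((c ⬝ᵥ c : ℤ) : ℝ) * v)]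
      exact Finset.sum_le_sum_of_subset_of_nonneg hS fun _ _ _ => discreteNormal_nonneg _ _ _ _
    have h3 : μ.real {ω | c ⬝ᵥ (fun j => e j ω) ∈ S} ≤ (1 + lawConst κ * ε) * g := by
      refine (hsum _).trans ?_
      rw [hg, Finset.mul_sum]
      refine Finset.sum_le_sum fun y hy => ?_
      rw [discreteNormal_zero_of_mem (hS hy), mul_div_assoc',
        le_div_iff₀ (windowMass_pos D.q_pos _ _)]
      exact D.law_linearForm_le y 0
    have h4 : lawConst κ * ε * g ≤ lawConst κ * ε := mul_le_of_le_one_right (by positivity) hg1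
    linarith

end NoiseData

end

/-! ### Mixtures -/

theorem statDist_nonneg (f g : ℤ → ℝ) : 0 ≤ statDist f g :=
  mul_nonneg (by norm_num) (tsum_nonneg fun _ => abs_nonneg _)

theorem avg_const (K : ℕ) (b : ℝ) :
    1 / (1 + 2 * (K : ℝ)) * ∑ _k ∈ Finset.Icc (-(K : ℤ)) (K : ℤ), b = b := by
  rw [Finset.sum_const, Int.card_Icc, nsmul_eq_mul]
  have h : ((K + 1 - -(K : ℤ)).toNat : ℝ) = 1 + 2 * K := by
    have : (K + 1 - -(K : ℤ)).toNat = 1 + 2 * K := by omega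
    rw [this]; push_cast; ring
  rw [h]
  field_simp

/-- Replacing one of two independent variables by a uniform one costs twice the statistical
distance. -/
theorem measure_indep_le {Ω : Type*} [MeasurableSpace Ω] {μ : Measure Ω} [IsProbabilityMeasure μ]
    {U W : Ω → ℤ} (hU : Measurable U) (hUW : IndepFun U W μ) (K : ℕ) (A : ℤ → Set ℤ) :
    μ.real {ω | W ω ∈ A (U ω)} ≤ 2 * statDist (fun k => μ.real {ω | U ω = k}) (symUniform K) +
      1 / (1 + 2 * (K : ℝ)) * ∑ k ∈ Finset.Icc (-(K : ℤ)) (K : ℤ), μ.real {ω | W ω ∈ A k} := by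
  set u : ℤ → ℝ := fun k => μ.real {ω | U ω = k} with hu
  set h : ℤ → ℝ := fun k => μ.real {ω | W ω ∈ A k} with hh
  have hmeas : ∀ k, MeasurableSet {ω | U ω = k} := fun k => hU (measurableSet_singleton k)
  have hus : Summable u := by
    refine ENNReal.summable_toReal ?_
    rw [← measure_iUnion (fun i j hij => ?_) hmeas]
    · exact measure_ne_top _ _
    · exact Set.disjoint_left.2 fun ω hi hj => hij (hi.symm.trans hj)
  have hfs : ∀ f : ℤ → ℝ, ∀ k ∉ Finset.Icc (-(K : ℤ)) (K : ℤ), symUniform K k * f k = 0 :=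
    fun f k hk => by simp only [symUniform, if_neg hk, zero_mul]
  have hss : Summable (symUniform K) :=
    (summable_of_ne_finset_zero (hfs 1)).congr fun k => by simp
  have h0 : ∀ k, 0 ≤ h k := fun k => measureReal_nonneg
  have h1 : ∀ k, h k ≤ 1 := fun k => measureReal_le_one
  have huh : Summable fun k => u k * h k :=
    Summable.of_nonneg_of_le (fun k => mul_nonneg measureReal_nonneg (h0 k))
      (fun k => mul_le_of_le_one_right measureReal_nonneg (h1 k)) hus
  have hsh : Summable fun k => symUniform K k * h k := summable_of_ne_finset_zero (hfs h)
  have habs : Summable fun k => |u k - symUniform K k| := (hus.sub hss).abs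
  have e1 : μ.real {ω | W ω ∈ A (U ω)} ≤ ∑' k, u k * h k := by
    refine ENNReal.toReal_le_of_le_ofReal (tsum_nonneg fun k => mul_nonneg measureReal_nonneg (h0 k)) ?_
    rw [ENNReal.ofReal_tsum_of_nonneg (fun k => mul_nonneg measureReal_nonneg (h0 k)) huh]
    have hsub : {ω | W ω ∈ A (U ω)} ⊆ ⋃ k : ℤ, U ⁻¹' {k} ∩ W ⁻¹' (A k) := fun ω hω =>
      Set.mem_iUnion.2 ⟨U ω, rfl, hω⟩
    refine (measure_mono hsub).trans ((measure_iUnion_le _).trans (ENNReal.tsum_le_tsum fun k => ?_))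
    rw [hUW.measure_inter_preimage_eq_mul _ _ (measurableSet_singleton k) MeasurableSet.of_discrete,
      ENNReal.ofReal_mul measureReal_nonneg, ofReal_measureReal, ofReal_measureReal]
    rfl
  have e2 : ∑' k, u k * h k ≤ ∑' k, (|u k - symUniform K k| + symUniform K k * h k) := by
    refine huh.tsum_le_tsum (fun k => ?_) (habs.add hsh)
    have := le_abs_self (u k - symUniform K k)
    have := abs_nonneg (u k - symUniform K k)
    nlinarith [h0 k, h1 k]
  rw [habs.tsum_add hsh, tsum_eq_sum (hfs h)] at e2
  have e3 : ∑ k ∈ Finset.Icc (-(K : ℤ)) (K : ℤ), symUniform K k * h k =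
      1 / (1 + 2 * (K : ℝ)) * ∑ k ∈ Finset.Icc (-(K : ℤ)) (K : ℤ), h k := by
    rw [Finset.mul_sum]
    exact Finset.sum_congr rfl fun k hk => by rw [symUniform, if_pos hk]
  rw [e3] at e2
  unfold statDist
  linarith

theorem sum_shiftMixture {q : ℕ} (hq : 0 < q) (r K : ℕ) (w : ℝ) :
    ∑ y ∈ Zq q, shiftMixture q r K w y = 1 := by
  unfold shiftMixture
  rw [← Finset.mul_sum, Finset.sum_comm]
  rw [Finset.sum_congr rfl fun k _ => (sum_Zq_cmod_sub hq (k * r) _).trans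
    (sum_discreteNormal ⟨0, zero_mem_Zq hq⟩ 0 w)]
  exact avg_const K 1

theorem sum_meanMixture {q : ℕ} (hq : 0 < q) (r K : ℕ) (w : ℝ) :
    ∑ y ∈ Zq q, meanMixture q r K w y = 1 := by
  unfold meanMixture
  rw [← Finset.mul_sum, Finset.sum_comm]
  rw [Finset.sum_congr rfl fun k _ => sum_discreteNormal ⟨0, zero_mem_Zq hq⟩ _ w]
  exact avg_const K 1

theorem shiftMixture_nonneg (q r K : ℕ) (w : ℝ) (y : ℤ) : 0 ≤ shiftMixture q r K w y :=
  mul_nonneg (by positivity) (Finset.sum_nonneg fun _ _ => discreteNormal_nonneg _ _ _ _)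

theorem meanMixture_nonneg (q r K : ℕ) (w : ℝ) (y : ℤ) : 0 ≤ meanMixture q r K w y :=
  mul_nonneg (by positivity) (Finset.sum_nonneg fun _ _ => discreteNormal_nonneg _ _ _ _)

theorem cmod_add_cmod {q : ℕ} (hq : 0 < q) (a b : ℤ) : cmod (a + cmod b q) q = cmod (a + b) q := by
  rw [cmod_eq_cmod_iff hq]
  simpa using dvd_cmod_sub b q

/-- A one-sided bound over all sets of residues is two-sided. -/
theorem abs_measure_sub_le {Ω : Type*} [MeasurableSpace Ω] {μ : Measure Ω} [IsProbabilityMeasure μ]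
    {X : Ω → ℤ} (hX : Measurable X) {q : ℕ} (hXq : ∀ ω, X ω ∈ Zq q) {m : ℤ → ℝ} {b : ℝ}
    (hm : ∑ y ∈ Zq q, m y = 1)
    (h : ∀ S ⊆ Zq q, μ.real {ω | X ω ∈ S} ≤ ∑ y ∈ S, m y + b) {S : Finset ℤ} (hS : S ⊆ Zq q) :
    |μ.real {ω | X ω ∈ S} - ∑ y ∈ S, m y| ≤ b := by
  have h1 := h S hS
  have h2 := h (Zq q \ S) Finset.sdiff_subset
  have h3 : {ω | X ω ∈ Zq q \ S} = {ω | X ω ∈ S}ᶜ := by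
    ext ω
    simp [hXq ω]
  have h5 : MeasurableSet {ω | X ω ∈ S} := hX (MeasurableSet.of_discrete (s := (S : Set ℤ)))
  rw [h3, probReal_compl_eq_one_sub h5] at h2
  have h4 := Finset.sum_sdiff (f := m) hS
  rw [abs_le]
  constructor <;> linarith

/-- The difference is `P(A | H) P(Hᶜ) - P(Hᶜ ∩ A)`, and both terms lie between `0` and `P(Hᶜ)`. -/
theorem abs_cond_sub_le {Ω : Type*} [MeasurableSpace Ω] {μ : Measure Ω} [IsProbabilityMeasure μ]
    {H : Set Ω} (hH : MeasurableSet H) (A : Set Ω) :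
    |(cond μ H).real A - μ.real A| ≤ μ.real Hᶜ := by
  rw [measureReal_def, cond_apply hH, ENNReal.toReal_mul, ENNReal.toReal_inv, ← measureReal_def,
    ← measureReal_def]
  have h1 := probReal_compl_eq_one_sub (μ := μ) hH
  have h2 : μ.real (H ∩ A) + μ.real (Hᶜ ∩ A) = μ.real A := by
    have := measureReal_inter_add_sdiff (μ := μ) (s := A) hH
    rw [← this, Set.inter_comm A H, Set.sdiff_eq, Set.inter_comm A Hᶜ]
  have h3 : μ.real (H ∩ A) ≤ μ.real H := measureReal_mono Set.inter_subset_left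
  have h4 : μ.real (Hᶜ ∩ A) ≤ μ.real Hᶜ := measureReal_mono Set.inter_subset_left
  have h5 : 0 ≤ μ.real (H ∩ A) := measureReal_nonneg
  have h6 : 0 ≤ μ.real (Hᶜ ∩ A) := measureReal_nonneg
  have h8 : 0 ≤ μ.real H := measureReal_nonneg
  -- If `H` is null, conditioning gives the zero measure by convention, while `Hᶜ` has mass `1`.
  rcases h8.eq_or_lt with h7 | h7
  · rw [← h7] at h1 h3 ⊢
    rw [abs_le]
    constructor <;> simp <;> linarith
  · have h9 : (μ.real H)⁻¹ * μ.real (H ∩ A) * μ.real Hᶜ =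
        (μ.real H)⁻¹ * μ.real (H ∩ A) - μ.real (H ∩ A) := by
      rw [h1]
      field_simp
    have h10 : (μ.real H)⁻¹ * μ.real (H ∩ A) ≤ 1 := by
      rw [inv_mul_le_iff₀ h7]; linarith
    have h11 : 0 ≤ (μ.real H)⁻¹ * μ.real (H ∩ A) := by positivity
    have h12 : 0 ≤ μ.real Hᶜ := measureReal_nonneg
    have h13 := mul_le_of_le_one_left h12 h10
    have h14 := mul_nonneg h11 h12
    rw [abs_le]
    constructor <;> linarith

theorem measurable_comp_pair {Ω α β γ : Type*} [MeasurableSpace Ω] [MeasurableSpace α]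
    [MeasurableSpace β] [MeasurableSpace γ] [Countable α] [Countable β]
    [MeasurableSingletonClass α] [MeasurableSingletonClass β] (f : α → β → γ) {x : Ω → α}
    {y : Ω → β} (hx : Measurable x) (hy : Measurable y) : Measurable fun ω => f (x ω) (y ω) :=
  (measurable_of_countable (Function.uncurry f)).comp (hx.prodMk hy)

/-! ### One-sided bounds for the sum of shift and noise -/

namespace NoiseData

variable {ι : Type*} [Fintype ι] {Ω : Type*} [MeasurableSpace Ω] {μ : Measure Ω}
  [IsProbabilityMeasure μ] {e : ι → Ω → ℤ} {c : ι → ℤ} {q : ℕ} {v ε κ : ℝ}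

/-- For a fixed shift `k`, translation by `r k` permutes the residues, so the noise bound applies to
the translated set. -/
theorem measure_shift_le (D : NoiseData μ e c q v ε κ) {U : Ω → ℤ} (hU : Measurable U)
    (hUW : IndepFun U (fun ω => c ⬝ᵥ fun j => e j ω) μ) (r K : ℕ) {S : Finset ℤ} (hS : S ⊆ Zq q) :
    μ.real {ω | cmod (r * U ω + c ⬝ᵥ fun j => e j ω) q ∈ S} ≤
      ∑ y ∈ S, shiftMixture q r K (((c ⬝ᵥ c : ℤ) : ℝ) * v) y +
      (2 * statDist (fun k => μ.real {ω | U ω = k}) (symUniform K) +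
        (lawConst κ + (1 + lawConst κ) * (2 * tailConst κ)) * ε) := by
  have h1 := measure_indep_le hU hUW K fun k => {w | cmod (r * k + w) q ∈ S}
  set w := ((c ⬝ᵥ c : ℤ) : ℝ) * v
  set E := (lawConst κ + (1 + lawConst κ) * (2 * tailConst κ)) * ε
  refine h1.trans ?_
  have h2 : ∀ k : ℤ, μ.real {ω | cmod (r * k + c ⬝ᵥ fun j => e j ω) q ∈ S} ≤
      ∑ y ∈ S, discreteNormal (Zq q) 0 w (cmod (y - k * r) q) + E := fun k => by
    have h3 := D.measure_cmod_linearForm_le (S := (Zq q).filter fun y => cmod (r * k + y) q ∈ S)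
      (Finset.filter_subset _ _)
    have h4 : ∀ ω, cmod (c ⬝ᵥ fun j => e j ω) q ∈
        (Zq q).filter (fun y => cmod (r * k + y) q ∈ S) ↔
        cmod (r * k + c ⬝ᵥ fun j => e j ω) q ∈ S := fun ω => by
      rw [Finset.mem_filter, cmod_add_cmod D.q_pos]
      exact and_iff_right (cmod_mem_Zq _ D.q_pos)
    simp_rw [h4] at h3
    have h5 : ∑ y ∈ (Zq q).filter (fun y => cmod (r * k + y) q ∈ S), discreteNormal (Zq q) 0 w y =
        ∑ y ∈ S, discreteNormal (Zq q) 0 w (cmod (y - k * r) q) := by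
      have h6 : ∀ y ∈ Zq q, cmod (cmod (r * k + y) q - k * r) q = y := fun y hy => by
        rw [cmod_eq_iff D.q_pos hy]
        have := dvd_cmod_sub (r * k + y) q
        convert this using 1
        ring
      have h7 : ∀ y ∈ Zq q, cmod (r * k + cmod (y - k * r) q) q = y := fun y hy => by
        rw [cmod_add_cmod D.q_pos, cmod_eq_iff D.q_pos hy]
        exact ⟨0, by ring⟩
      refine Finset.sum_nbij' (fun y => cmod (r * k + y) q) (fun y => cmod (y - k * r) q)
        (fun y hy => (Finset.mem_filter.1 hy).2) (fun y hy => ?_)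
        (fun y hy => h6 y (Finset.mem_filter.1 hy).1) (fun y hy => h7 y (hS hy)) (fun y hy => ?_)
      · rw [Finset.mem_filter, h7 y (hS hy)]
        exact ⟨cmod_mem_Zq _ D.q_pos, hy⟩
      · rw [h6 y (Finset.mem_filter.1 hy).1]
    rwa [h5] at h3
  have h8 : 1 / (1 + 2 * (K : ℝ)) * ∑ k ∈ Finset.Icc (-(K : ℤ)) (K : ℤ),
      μ.real {ω | cmod (r * k + c ⬝ᵥ fun j => e j ω) q ∈ S} ≤
      ∑ y ∈ S, shiftMixture q r K w y + E := by
    refine (mul_le_mul_of_nonneg_left (Finset.sum_le_sum fun k _ => h2 k) (by positivity)).trans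
      (le_of_eq ?_)
    rw [Finset.sum_add_distrib, mul_add, avg_const, Finset.sum_comm]
    unfold shiftMixture
    rw [Finset.mul_sum]
  simp only [Set.mem_ofPred_eq] at *
  linarith

/-- Without overflow no reduction takes place, and `y - k r` need not be a residue. Domination is
therefore used with the normalising window centred at `-k r`, that is, with the mass of the normal
law of mean `k r`. -/
theorem measure_mean_le (D : NoiseData μ e c q v ε κ) {U : Ω → ℤ} (hU : Measurable U)
    (hUW : IndepFun U (fun ω => c ⬝ᵥ fun j => e j ω) μ) (r K : ℕ) {S : Finset ℤ} (hS : S ⊆ Zq q)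
    (hover : μ.real {ω | r * U ω + (c ⬝ᵥ fun j => e j ω) ∉ Zq q} ≤ κ * ε) :
    μ.real {ω | cmod (r * U ω + c ⬝ᵥ fun j => e j ω) q ∈ S} ≤
      ∑ y ∈ S, meanMixture q r K (((c ⬝ᵥ c : ℤ) : ℝ) * v) y +
      (2 * statDist (fun k => μ.real {ω | U ω = k}) (symUniform K) +
        (κ + lawConst κ) * ε) := by
  have h1 := measure_indep_le hU hUW K fun k => {w | r * k + w ∈ S}
  have hlaw := D.law_linearForm_le
  set w := ((c ⬝ᵥ c : ℤ) : ℝ) * v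
  have h0 : μ.real {ω | cmod (r * U ω + c ⬝ᵥ fun j => e j ω) q ∈ S} ≤
      μ.real {ω | r * U ω + (c ⬝ᵥ fun j => e j ω) ∈ S} +
      μ.real {ω | r * U ω + (c ⬝ᵥ fun j => e j ω) ∉ Zq q} := by
    refine le_trans (measureReal_mono fun ω hω => ?_) (measureReal_union_le _ _)
    by_cases hi : r * U ω + (c ⬝ᵥ fun j => e j ω) ∈ Zq q
    · left
      rwa [Set.mem_ofPred_eq, cmod_of_mem D.q_pos hi] at hω
    · exact Or.inr hi
  have hL := mul_pos (lawConst_pos D.κ_pos) D.ε_pos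
  have h2 : ∀ k : ℤ, μ.real {ω | r * k + (c ⬝ᵥ fun j => e j ω) ∈ S} ≤
      ∑ y ∈ S, discreteNormal (Zq q) ((k : ℝ) * (r : ℝ)) w y + lawConst κ * ε := fun k => by
    have hcast : ((k : ℝ) * (r : ℝ)) = ((k * r : ℤ) : ℝ) := by push_cast; ring
    rw [hcast]
    have h3 : μ.real {ω | r * k + (c ⬝ᵥ fun j => e j ω) ∈ S} ≤
        ∑ y ∈ S, μ.real {ω | (c ⬝ᵥ fun j => e j ω) = y - k * r} := by
      refine le_trans (measureReal_mono (fun ω hω => ?_) (measure_ne_top _ _))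
        (measureReal_biUnion_finset_le S _)
      refine Set.mem_biUnion hω ?_
      rw [Set.mem_ofPred_eq]
      ring
    set g := ∑ y ∈ S, discreteNormal (Zq q) ((k * r : ℤ) : ℝ) w y with hg
    have hg1 : g ≤ 1 := by
      rw [← sum_discreteNormal ⟨0, zero_mem_Zq D.q_pos⟩ ((k * r : ℤ) : ℝ) w]
      exact Finset.sum_le_sum_of_subset_of_nonneg hS fun _ _ _ => discreteNormal_nonneg _ _ _ _
    have h4 : ∑ y ∈ S, μ.real {ω | (c ⬝ᵥ fun j => e j ω) = y - k * r} ≤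
        (1 + lawConst κ * ε) * g := by
      rw [hg, Finset.mul_sum]
      refine Finset.sum_le_sum fun y hy => ?_
      rw [discreteNormal_of_mem (hS hy), mul_div_assoc', le_div_iff₀ (windowMass_pos D.q_pos _ _)]
      exact hlaw (y - k * r) (k * r)
    have h5 : lawConst κ * ε * g ≤ lawConst κ * ε := mul_le_of_le_one_right hL.le hg1
    linarith
  have h8 : 1 / (1 + 2 * (K : ℝ)) * ∑ k ∈ Finset.Icc (-(K : ℤ)) (K : ℤ),
      μ.real {ω | r * k + (c ⬝ᵥ fun j => e j ω) ∈ S} ≤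
      ∑ y ∈ S, meanMixture q r K w y + lawConst κ * ε := by
    refine (mul_le_mul_of_nonneg_left (Finset.sum_le_sum fun k _ => h2 k) (by positivity)).trans
      (le_of_eq ?_)
    rw [Finset.sum_add_distrib, mul_add, avg_const, Finset.sum_comm]
    unfold meanMixture
    rw [Finset.mul_sum]
  simp only [Set.mem_ofPred_eq] at *
  linarith

end NoiseData

/-! ### The filtered ciphertext -/

section Filter

variable {ι ν τ : Type*} [Fintype ι] [Fintype ν] [Fintype τ]

theorem filteredNorm_eq (T : Matrix ι τ ℤ) (d : ι → ℤ) :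
    filteredNorm T d = Real.sqrt (((Tᵀ *ᵥ d) ⬝ᵥ (Tᵀ *ᵥ d) : ℤ) : ℝ) := by
  unfold filteredNorm
  congr 1
  simp [dotProduct, sq]

theorem filteredNorm_sq (T : Matrix ι τ ℤ) (d : ι → ℤ) :
    filteredNorm T d ^ 2 = (((Tᵀ *ᵥ d) ⬝ᵥ (Tᵀ *ᵥ d) : ℤ) : ℝ) := by
  rw [filteredNorm_eq, Real.sq_sqrt]
  exact_mod_cast Finset.sum_nonneg fun j _ => mul_self_nonneg _

theorem filteredVar_eq (σ : ℝ) (T : Matrix ι τ ℤ) (d : ι → ℤ) :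
    filteredVar σ T d = (((Tᵀ *ᵥ d) ⬝ᵥ (Tᵀ *ᵥ d) : ℤ) : ℝ) * σ ^ 2 := by
  set T' := T.map (Int.cast : ℤ → ℝ) with hT'
  set d' : ι → ℝ := fun i => (d i : ℝ) with hd'
  have h1 : ∀ j, (((Tᵀ *ᵥ d) j : ℤ) : ℝ) = (T'ᵀ *ᵥ d') j := fun j => by
    simp [mulVec, dotProduct, hT', hd']
  have h2 : (((Tᵀ *ᵥ d) ⬝ᵥ (Tᵀ *ᵥ d) : ℤ) : ℝ) = (T'ᵀ *ᵥ d') ⬝ᵥ (T'ᵀ *ᵥ d') := by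
    simp only [dotProduct]
    push_cast
    exact Finset.sum_congr rfl fun j _ => by rw [h1 j]
  rw [h2]
  unfold filteredVar residualCov
  rw [← hT', ← hd', smul_mulVec, dotProduct_smul, ← mulVec_mulVec, dotProduct_mulVec,
    ← mulVec_transpose, smul_eq_mul, mul_comm]

/-- Modulo `q`, `d` annihilates `P s`, and the reductions inside the ciphertext are invisible. -/
theorem filtered_eq_cmod {q : ℕ} (hq : 0 < q) (r : ℕ) (s : ν → ℤ) (P : Matrix ι ν ℤ)
    {d : ι → ℤ} (hd : d ∈ kerMod q Pᵀ) (m w : ι → ℤ) :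
    (filterCiphertext q d (encrypt q r s P m w)).2 = cmod (r * (d ⬝ᵥ m) + d ⬝ᵥ w) q := by
  unfold filterCiphertext encrypt
  rw [cmod_eq_cmod_iff hq]
  have h1 : (q : ℤ) ∣ d ⬝ᵥ (P *ᵥ s) := by
    rw [dotProduct_mulVec, ← mulVec_transpose]
    refine Finset.dvd_sum fun j _ => Dvd.dvd.mul_right ?_ _
    have := (cmod_eq_iff hq (zero_mem_Zq hq)).1 (hd.2 j)
    simpa using this
  have h2 : (q : ℤ) ∣ ∑ i, d i * (cmod ((P *ᵥ s) i + r * m i + w i) q -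
      ((P *ᵥ s) i + r * m i + w i)) :=
    Finset.dvd_sum fun i _ => (dvd_cmod_sub _ q).mul_left _
  have h3 : (d ⬝ᵥ fun i => cmod ((P *ᵥ s) i + r * m i + w i) q) - (r * (d ⬝ᵥ m) + d ⬝ᵥ w) =
      d ⬝ᵥ (P *ᵥ s) + ∑ i, d i * (cmod ((P *ᵥ s) i + r * m i + w i) q -
        ((P *ᵥ s) i + r * m i + w i)) := by
    unfold dotProduct
    rw [Finset.mul_sum, ← Finset.sum_add_distrib, ← Finset.sum_sub_distrib,
      ← Finset.sum_add_distrib]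
    exact Finset.sum_congr rfl fun i _ => by ring
  exact h3 ▸ dvd_add h1 h2

end Filter

end LWEDetect

end

/-! ### The Type I error of the test -/

open LWEDetect MeasureTheory ProbabilityTheory Matrix in
theorem mainTheorem3 (κ : ℝ) (hκ : 0 < κ) :
    ∃ C : ℝ, 0 < C ∧
    ∀ (N p v M q r εinf ε₀ : ℕ) (hq : 0 < q) (hr : 0 < r)
      (ε σ Ωε : ℝ) (hε : 0 < ε) (hε1 : ε < 1) (hσ : 0 < σ) (hΩ : 0 < Ωε) (hΩ1 : Ωε < 1)
      -- public matrix, secret vector, noise transformation, filtering vector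
      (P : Matrix (Fin N × Fin p) (Fin v) ℤ) (s : Fin v → ℤ)
      (T : Matrix (Fin N × Fin p) (Fin M) ℤ) (d : Fin N × Fin p → ℤ)
      (hP : ∀ i j, P i j ∈ Zq q) (hs : ∀ j, s j ∈ Zq q)
      (hd : d ∈ kerMod q Pᵀ)
      (hgcd : Finset.univ.gcd (Tᵀ *ᵥ d) = 1)
      -- the noise level is large enough, and not too large
      (hsmooth : filteredNorm T d ^ 2 * smoothingParameter intLattice ε ^ 2 ≤ σ ^ 2)
      (hupper : σ ^ 2 < (q : ℝ) ^ 2 / 4 * (Ωε ^ 2 / filteredNorm T d ^ 2))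
      (htail : ∑ x ∈ (Zq q).filter (fun x : ℤ => (q : ℝ) / 2 < filteredNorm T d * |(x : ℝ)|),
        discreteNormal (Zq q) 0 (σ ^ 2) x ≤ κ * ε)
      -- the random plaintext residual and the encryption noise
      {Ω : Type*} [MeasurableSpace Ω] (μ : Measure Ω) [IsProbabilityMeasure μ]
      (ρ : Ω → Fin N × Fin p → ℤ) (e : Fin M → Ω → ℤ)
      (hρ : Measurable ρ) (he : ∀ j, Measurable (e j))
      (helaw : ∀ j (x : ℤ), μ.real {ω | e j ω = x} = discreteNormal (Zq q) 0 (σ ^ 2) x)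
      (heind : iIndepFun e μ)
      (hρe : IndepFun ρ (fun ω j => e j ω) μ)
      (hnull : ∀ᵐ ω ∂μ, NullHypothesis εinf ε₀ (ρ ω))
      -- the encrypted residual and the filtered quantity
      (ρe : Ω → Matrix (Fin N × Fin p) (Fin v) ℤ × (Fin N × Fin p → ℤ)) (X : Ω → ℤ)
      (hρenc : ∀ ω, ρe ω = encrypt q r s P (ρ ω) (T *ᵥ fun j => e j ω))
      (hX : ∀ ω, filterCiphertext q d (ρe ω) = (0, X ω))
      -- the rejection set and its probability
      (S : Finset ℤ) (hS : S ⊆ Zq q) (α : ℝ)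
      (hα : ∑ y ∈ S, shiftMixture q r (εinf * largestL1 ε₀ d) (filteredVar σ T d) y = α ∨
        (μ.real {ω | r * (d ⬝ᵥ ρ ω) + d ⬝ᵥ (T *ᵥ fun j => e j ω) ∉ Zq q} ≤ κ * ε ∧
          ∑ y ∈ S, meanMixture q r (εinf * largestL1 ε₀ d) (filteredVar σ T d) y = α)),
      |μ.real {ω | X ω ∈ S} - α| ≤
          C * (ε + statDist (fun k => μ.real {ω | d ⬝ᵥ ρ ω = k})
            (symUniform (εinf * largestL1 ε₀ d))) ∧
      (μ.real {ω | decrypt q r s (ρe ω) ≠ ρ ω} ≤ κ * ε →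
        |(cond μ {ω | NullHypothesis εinf ε₀ (decrypt q r s (ρe ω))}).real {ω | X ω ∈ S} - α| ≤
          C * (ε + statDist (fun k => μ.real {ω | d ⬝ᵥ ρ ω = k})
            (symUniform (εinf * largestL1 ε₀ d)))) := by
  obtain ⟨L, hL0, hLdef⟩ : ∃ L : ℝ, 0 < L ∧
      L = lawConst κ + (1 + lawConst κ) * (2 * tailConst κ) := by
    have := lawConst_pos hκ
    have := tailConst_pos hκ
    exact ⟨_, by positivity, rfl⟩
  -- The `2` pays for the statistical distance, `L` for the law of the noise, one `κ` for overflow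
  -- and the other for decryption failure; `exp (36π)` serves the case `σ² < 36‖c‖²`.
  refine ⟨2 + L + κ + κ + Real.exp (36 * Real.pi), by positivity, ?_⟩
  intro N p v M q r εinf ε₀ hq hr ε σ Ωε hε hε1 hσ hΩ hΩ1 P s T d hP hs hd hgcd hsmooth hupper htail
    Ω _ μ _ ρ e hρ he helaw heind hρe hnull ρe X hρenc hX S hS α hα
  set c := Tᵀ *ᵥ d with hc
  set K := εinf * largestL1 ε₀ d with hK
  set Δ := statDist (fun k => μ.real {ω | d ⬝ᵥ ρ ω = k}) (symUniform K) with hΔ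
  clear_value c K
  have hΔ0 : 0 ≤ Δ := statDist_nonneg _ _
  have hnorm := filteredNorm_sq T d
  rw [← hc] at hnorm
  rw [filteredVar_eq, ← hc] at hα
  rw [hnorm] at hsmooth hupper
  have hTe : ∀ ω, d ⬝ᵥ (T *ᵥ fun j => e j ω) = c ⬝ᵥ fun j => e j ω := fun ω => by
    rw [dotProduct_mulVec, hc, mulVec_transpose]
  have hXeq : ∀ ω, X ω = cmod (r * (d ⬝ᵥ ρ ω) + c ⬝ᵥ fun j => e j ω) q := fun ω => by
    have h := filtered_eq_cmod hq r s P hd (ρ ω) (T *ᵥ fun j => e j ω)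
    rwa [← hρenc, hX, hTe] at h
  have hXq : ∀ ω, X ω ∈ Zq q := fun ω => by
    rw [hXeq]; exact cmod_mem_Zq _ hq
  have hemeas : Measurable fun ω j => e j ω := measurable_pi_lambda _ he
  have hXmeas : Measurable X := by
    rw [funext hXeq]
    exact measurable_comp_pair (fun (x : Fin N × Fin p → ℤ) (y : Fin M → ℤ) =>
      cmod (r * (d ⬝ᵥ x) + c ⬝ᵥ y) q) hρ hemeas
  have hU : Measurable fun ω => d ⬝ᵥ ρ ω :=
    (Measurable.of_discrete (f := fun x : Fin N × Fin p → ℤ => d ⬝ᵥ x)).comp hρ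
  have hUW : IndepFun (fun ω => d ⬝ᵥ ρ ω) (fun ω => c ⬝ᵥ fun j => e j ω) μ :=
    hρe.comp (φ := fun x : Fin N × Fin p → ℤ => d ⬝ᵥ x) (ψ := fun x : Fin M → ℤ => c ⬝ᵥ x)
      Measurable.of_discrete Measurable.of_discrete
  have hcc0 : 0 < c ⬝ᵥ c := by
    obtain ⟨i, -, hi⟩ := Finset.gcd_ne_zero_iff.1 (by rw [hgcd]; exact one_ne_zero)
    refine lt_of_lt_of_le (mul_self_pos.2 hi) ?_
    exact Finset.single_le_sum (f := fun i => c i * c i) (fun j _ => mul_self_nonneg _)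
      (Finset.mem_univ i)
  have hn : (0 : ℝ) < ((c ⬝ᵥ c : ℤ) : ℝ) := by exact_mod_cast hcc0
  have hα01 : 0 ≤ α ∧ α ≤ 1 := by
    rcases hα with rfl | ⟨-, rfl⟩
    · refine ⟨Finset.sum_nonneg fun _ _ => shiftMixture_nonneg _ _ _ _ _, ?_⟩
      rw [← sum_shiftMixture hq r K (((c ⬝ᵥ c : ℤ) : ℝ) * σ ^ 2)]
      exact Finset.sum_le_sum_of_subset_of_nonneg hS fun _ _ _ => shiftMixture_nonneg _ _ _ _ _
    · refine ⟨Finset.sum_nonneg fun _ _ => meanMixture_nonneg _ _ _ _ _, ?_⟩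
      rw [← sum_meanMixture hq r K (((c ⬝ᵥ c : ℤ) : ℝ) * σ ^ 2)]
      exact Finset.sum_le_sum_of_subset_of_nonneg hS fun _ _ _ => meanMixture_nonneg _ _ _ _ _
  have hexp := exp_le_of_smoothing hε hε1 hn hsmooth
  have hmain : |μ.real {ω | X ω ∈ S} - α| ≤
      (2 + L + κ + Real.exp (36 * Real.pi)) * (ε + Δ) := by
    -- In the negative case the smoothing condition forces `exp (-36π) ≤ ε / 2`, so the bound
    -- exceeds `1` and nothing remains to be shown about probabilities.
    by_cases hbig : 36 * ((c ⬝ᵥ c : ℤ) : ℝ) ≤ σ ^ 2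
    · have hwin := windowMass_pos hq (σ ^ 2) 0
      have D : NoiseData μ e c q (σ ^ 2) ε κ :=
        { q_pos := hq
          ε_pos := hε
          ε_lt_one := hε1
          κ_pos := hκ
          meas := he
          indep := heind
          law := helaw
          gcd := hgcd
          large := hbig
          upper := by
            rw [mul_div_assoc', lt_div_iff₀ hn] at hupper
            have h1 : (q : ℝ) ^ 2 / 4 * Ωε ^ 2 ≤ (q : ℝ) ^ 2 / 4 :=
              mul_le_of_le_one_right (by positivity) (pow_le_one₀ hΩ.le hΩ1.le)
            linarith
          smooth := hexp
          outer := by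
            rw [filteredNorm_eq, ← hc] at htail
            rw [← div_le_iff₀ hwin]
            refine le_trans (le_of_eq ?_) htail
            rw [outerMass, Finset.sum_div]
            exact Finset.sum_congr rfl fun x hx =>
              (discreteNormal_zero_of_mem (Finset.mem_filter.1 hx).1).symm }
      have hE := Real.exp_pos (36 * Real.pi)
      have hL1 : lawConst κ ≤ L := by
        rw [hLdef]
        have := lawConst_pos hκ
        have := tailConst_pos hκ
        exact le_add_of_nonneg_right (by positivity)
      have hfin : ∀ b : ℝ, b ≤ L + κ → 2 * Δ + b * ε ≤
          (2 + L + κ + Real.exp (36 * Real.pi)) * (ε + Δ) := fun b hb => by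
        have h1 := mul_le_mul_of_nonneg_right hb hε.le
        have h2 : 0 ≤ (L + κ + Real.exp (36 * Real.pi)) * Δ := by positivity
        have h3 : 0 ≤ (2 + Real.exp (36 * Real.pi)) * ε := by positivity
        linarith
      rcases hα with rfl | ⟨hover, rfl⟩
      · refine (abs_measure_sub_le hXmeas hXq (sum_shiftMixture hq r K _) (fun S' hS' => ?_) hS).trans
          (hfin L (by linarith))
        have h := D.measure_shift_le hU hUW r K hS'
        simp_rw [hXeq, hLdef]
        exact h
      · refine (abs_measure_sub_le hXmeas hXq (sum_meanMixture hq r K _) (fun S' hS' => ?_) hS).trans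
          (hfin (κ + lawConst κ) (by linarith))
        simp_rw [hTe] at hover
        have h := D.measure_mean_le hU hUW r K hS' hover
        simp_rw [hXeq]
        exact h
    · have h1 : |μ.real {ω | X ω ∈ S} - α| ≤ 1 := by
        have h2 : μ.real {ω | X ω ∈ S} ≤ 1 := measureReal_le_one
        have h3 : 0 ≤ μ.real {ω | X ω ∈ S} := measureReal_nonneg
        rw [abs_le]
        constructor <;> linarith [hα01.1, hα01.2]
      have h4 : Real.exp (-(36 * Real.pi)) ≤ ε / 2 := by
        refine le_trans (Real.exp_le_exp.2 (neg_le_neg ?_)) hexp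
        rw [div_le_iff₀ hn]
        nlinarith [Real.pi_pos]
      rw [Real.exp_neg] at h4
      have h5 : 1 ≤ Real.exp (36 * Real.pi) * ε := by
        have := (inv_le_iff_one_le_mul₀' (Real.exp_pos (36 * Real.pi))).1 h4
        nlinarith [Real.exp_pos (36 * Real.pi)]
      have h6 : 0 ≤ (2 + L + κ) * (ε + Δ) := by positivity
      have h7 : 0 ≤ Real.exp (36 * Real.pi) * Δ := by positivity
      linarith
  refine ⟨hmain.trans ?_, fun hdec => ?_⟩
  · have : 0 ≤ κ * (ε + Δ) := by positivity
    linarith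
  · have hHmeas : MeasurableSet {ω | NullHypothesis εinf ε₀ (decrypt q r s (ρe ω))} := by
      rw [funext hρenc]
      exact measurableSet_setOfPred.2 (measurable_comp_pair
        (fun (x : Fin N × Fin p → ℤ) (y : Fin M → ℤ) =>
          NullHypothesis εinf ε₀ (decrypt q r s (encrypt q r s P x (T *ᵥ y)))) hρ hemeas)
    have h1 := abs_cond_sub_le (μ := μ) hHmeas {ω | X ω ∈ S}
    -- Wherever decryption is correct, the decrypted message satisfies the null hypothesis almost
    -- surely, so the conditioning event fails with probability at most `κε`.
    have h2 : μ.real {ω | NullHypothesis εinf ε₀ (decrypt q r s (ρe ω))}ᶜ ≤ κ * ε := by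
      have h3 : μ.real {ω | ¬ NullHypothesis εinf ε₀ (ρ ω)} = 0 := by
        rw [measureReal_def, ae_iff.1 hnull, ENNReal.toReal_zero]
      have h4 : μ.real {ω | NullHypothesis εinf ε₀ (decrypt q r s (ρe ω))}ᶜ ≤
          μ.real {ω | decrypt q r s (ρe ω) ≠ ρ ω} +
          μ.real {ω | ¬ NullHypothesis εinf ε₀ (ρ ω)} := by
        refine le_trans (measureReal_mono fun ω hω => ?_) (measureReal_union_le _ _)
        by_cases h5 : decrypt q r s (ρe ω) = ρ ω
        · right
          rw [Set.mem_ofPred_eq, ← h5]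
          exact hω
        · exact Or.inl h5
      linarith
    have h6 := abs_sub_le ((cond μ {ω | NullHypothesis εinf ε₀ (decrypt q r s (ρe ω))}).real
      {ω | X ω ∈ S}) (μ.real {ω | X ω ∈ S}) α
    have h7 : 0 ≤ κ * Δ := by positivity
    linarith
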